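/- **Setting.** Clients $1,\dots,n$ are served one at a time, in this order, by a single server that is never idle while a client is present. Their service times $B_1,\dots,B_n$ are i.i.d. exponential with rate $\mu>0$. At the moment client $j<n$ arrives, the arrival epoch of client $j+1$ is fixed: a (dynamic scheduling) policy prescribes the time $x_{j+1}\ge 0$ between these two arrivals as a measurable function of $j$, the number of clients in the system immediately after the arrival of client $j$, and the elapsed service time of the client in service. Let $\omega\in[0,1]$. For $1\le k\le i\le n$ and $u\ge 0$, let $C_i(k,u)$ be the infimum over all policies of the conditional expectation of $$\omega\sum_{j=i+1}^n I_j+(1-\omega)\sum_{j=i-k+1}^n W_j,$$ given that immediately after the arrival of client $i$ there are $k$ clients in the system (the clients $i-k+1,\dots,i$) and that the client in service has elapsed service time $u$ (so that her service time is conditioned on exceeding $u$). Here $I_j$ is the time that the server is idle between the departure of client $j-1$ and the arrival of client $j$, and $W_j$ is the waiting time of client $j$ incurred from the arrival of client $i$ on. For $r\ge 0$ let $F_r(m)=\mathbb P(\mathrm{Pois}(r)\le m)$, and for $k\ge 1$, $t\ge 0$ and $\ell=2,\dots,k+1$ put $$f_k(t)=t\,(1-F_{\mu t}(k-1))-\frac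 k\mu\,(1-F_{\mu t}(k)),$$ $$g_k(t)=(k-1)\,t\,F_{\mu t}(k-1)-\frac{\mu t^2}{2}F_{\mu t}(k-2)+\frac{k(k-1)}{2\mu}(1-F_{\mu t}(k)),$$ $$p_{k1}(t)=\sum_{m=k}^\infty e^{-\mu t}\frac{(\mu t)^m}{m!},\qquad p_{k\ell}(t)=e^{-\mu t}\frac{(\mu t)^{k-\ell+1}}{(k-\ell+1)!}.$$ **Theorem.** $C_i(k,u)$ is finite and does not depend on $u$; write $C_i(k)$ for its value. For $i=1,\dots,n-1$ and $k=1,\dots,i$, $$C_i(k)=\inf_{t\ge 0}\Big(\omega f_k(t)+(1-\omega)g_k(t)+\sum_{\ell=1}^{k+1}p_{k\ell}(t)\,C_{i+1}(\ell)\Big),$$ and for $k=1,\dots,n$, $$C_n(k)=(1-\omega)\,g_k(\infty)=(1-\omega)\,\frac{k(k-1)}{2\mu},\qquad\text{where } g_k(\infty)=\lim_{t\to\infty}g_k(t).$$ -/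

import Mathlib

open MeasureTheory ProbabilityTheory Filter Topology
open scoped NNReal ENNReal

noncomputable section

namespace Appointment

/-! ### The single-server queue

Clients are numbered `1, 2, …` and served in that order.  Time `0` is the arrival epoch of client
`i`.  Immediately after it there are `k` clients in the system, namely `i + 1 - k, …, i`, and the
one in service, client `first := i + 1 - k`, has been in service for `u` time units, that is, her
service started at time `-u`.

`t j` is the arrival epoch of client `j`; the clients that are already present get `t j = 0`, since
only costs made from time `0` on are counted.  `b j` is the (total) service time of client `j`. -/

/-- Epoch at which the service of client `j` starts (`j ≥ first`): client `first` started at `-u`,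
a later client starts at her arrival or at the departure of her predecessor, whichever is later. -/
def serviceStart (first : ℕ) (u : ℝ) (t b : ℕ → ℝ) : ℕ → ℝ
  | 0 => -u
  | j + 1 => if j + 1 ≤ first then -u else max (t (j + 1)) (serviceStart first u t b j + b j)

/-- Departure epoch of client `j`. -/
def departure (first : ℕ) (u : ℝ) (t b : ℕ → ℝ) (j : ℕ) : ℝ :=
  serviceStart first u t b j + b j

/-- Waiting time of client `j`, counted from time `0` on. -/
def waiting (first : ℕ) (u : ℝ) (t b : ℕ → ℝ) (j : ℕ) : ℝ :=
  max (serviceStart first u t b j - t j) 0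

/-- Idle time associated with client `j`: the time that the server is idle just before her
arrival. -/
def idle (first : ℕ) (u : ℝ) (t b : ℕ → ℝ) (j : ℕ) : ℝ :=
  max (t j - departure first u t b (j - 1)) 0

/-- Number of clients in the system immediately after the arrival of client `j`. -/
def numInSystem (first : ℕ) (u : ℝ) (t b : ℕ → ℝ) (j : ℕ) : ℕ :=
  ((Finset.Icc first j).filter fun p => t j < departure first u t b p).card

/-- Elapsed service time, immediately after the arrival of client `j`, of the client in service;
if `N` clients are present then this is client `j + 1 - N`. -/
def elapsed (first : ℕ) (u : ℝ) (t b : ℕ → ℝ) (j : ℕ) : ℝ :=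
  t j - serviceStart first u t b (j + 1 - numInSystem first u t b j)

/-! ### Dynamic schedules -/

/-- A dynamic scheduling policy: immediately after the arrival of client `j`, if there are `N`
clients in the system and the client in service has elapsed service time `v`, the time until the
arrival of client `j + 1` is set to `gap j N v`. -/
structure Policy where
  gap : ℕ → ℕ → ℝ → ℝ
  gap_nonneg : ∀ j N v, 0 ≤ gap j N v
  measurable_gap : ∀ j N, Measurable (gap j N)

/-- The arrival epochs under the policy `π`, after the first `m` scheduling decisions, so that the
epochs of the clients up to `i + m` have been fixed.  The decision for client `i + m + 1` only uses
the epochs fixed before. -/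
def arrival (i first : ℕ) (u : ℝ) (π : Policy) (b : ℕ → ℝ) : ℕ → ℕ → ℝ
  | 0 => fun _ => 0
  | m + 1 =>
    let t := arrival i first u π b m
    Function.update t (i + m + 1)
      (t (i + m) + π.gap (i + m) (numInSystem first u t b (i + m)) (elapsed first u t b (i + m)))

/-- The cost incurred from the arrival of client `i` until the end of the schedule of `n` clients,
when there are `k` clients immediately after this arrival and the one in service has elapsed service
time `u`: `w` times the idle times plus `1 - w` times the waiting times. -/
def cost (w : ℝ) (n i k : ℕ) (u : ℝ) (π : Policy) (b : ℕ → ℝ) : ℝ :=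
  w * ∑ j ∈ Finset.Icc (i + 1) n, idle (i + 1 - k) u (arrival i (i + 1 - k) u π b (n - i)) b j +
  (1 - w) * ∑ j ∈ Finset.Icc (i + 1 - k) n,
    waiting (i + 1 - k) u (arrival i (i + 1 - k) u π b (n - i)) b j

/-- `C_i(k, u)`: the infimum over all policies of the expected cost from the arrival of client `i`,
given that there are `k` clients immediately after this arrival and that the service time of the
one in service exceeds its elapsed part `u`. -/
def minCost {Ω : Type*} [MeasurableSpace Ω] (P : Measure Ω) (B : ℕ → Ω → ℝ) (w : ℝ) (n i k : ℕ)
    (u : ℝ) : ℝ≥0∞ :=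
  ⨅ π : Policy, ∫⁻ x, ENNReal.ofReal (cost w n i k u π fun j => B j x)
    ∂(ProbabilityTheory.cond P {x | u < B (i + 1 - k) x})

/-! ### The terms of the recursion -/

/-- `F_r(j) = ℙ(Pois(r) ≤ j)`, for `r ≥ 0` and an integer `j` (possibly negative). -/
def poissonCDF (r : ℝ) (j : ℤ) : ℝ :=
  (poissonMeasure r.toNNReal).real {m : ℕ | (m : ℤ) ≤ j}

/-- `f_k(t)`. -/
def idleTerm (μ : ℝ) (k : ℕ) (t : ℝ) : ℝ :=
  t * (1 - poissonCDF (μ * t) ((k : ℤ) - 1)) - (k : ℝ) / μ * (1 - poissonCDF (μ * t) (k : ℤ))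

/-- `g_k(t)`. -/
def waitTerm (μ : ℝ) (k : ℕ) (t : ℝ) : ℝ :=
  ((k : ℝ) - 1) * t * poissonCDF (μ * t) ((k : ℤ) - 1)
    - μ * t ^ 2 / 2 * poissonCDF (μ * t) ((k : ℤ) - 2)
    + (k : ℝ) * ((k : ℝ) - 1) / (2 * μ) * (1 - poissonCDF (μ * t) (k : ℤ))

/-- `p_{kℓ}(t)`, for `1 ≤ ℓ ≤ k + 1`. -/
def trans (μ : ℝ) (k l : ℕ) (t : ℝ) : ℝ :=
  if l = 1 then ∑' m : ℕ, Real.exp (-(μ * t)) * (μ * t) ^ (k + m) / ((k + m).factorial : ℝ)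
  else Real.exp (-(μ * t)) * (μ * t) ^ (k + 1 - l) / ((k + 1 - l).factorial : ℝ)

end Appointment

end

namespace Appointment

/-! The cost is first unfolded along a single path. The time origin can be moved to the next event,
a departure or the arrival of client `i + 1`. The waiting clients are charged the time elapsed, and
the server is charged its idle time if the system had emptied. What remains is a cost of the same
kind, because the policy sees only the number present and the elapsed service time, which the shift
preserves. This identifies `cost` with the recursion `recCost` (`ofReal_cost`).

In expectation, a client with elapsed service `u` has as service time `u` plus a fresh exponential,
independent of the others. If she outlasts the next gap `τ`, the same holds with `u + τ`. So the
mean of one step (`IsExpSequence.residualMean_stepCost`) obeys a recursion from which `u` has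
disappeared, namely `stepMean`. The expression inside the infimum of the theorem, `stepValue`,
solves the backward equation of a death process with rate `μ`. The integrated form of that equation
(`integral_stepValue`) is the recursion of `stepMean`, whence `stepMean_eq`.

The rest is dynamic programming with value function `optCost`. It bounds every policy from below
(`IsExpSequence.optCost_le`). A policy whose gaps are optimal up to `ε` in each state stays within
`m * ε` of it (`IsExpSequence.le_optCost`). Such gaps can be chosen independently of the elapsed
time, so no measurable selection is needed. -/

lemma serviceStart_of_le {first : ℕ} {u : ℝ} {t b : ℕ → ℝ} {j : ℕ} (h : j ≤ first) :
    serviceStart first u t b j = -u := by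
  cases j with
  | zero => rfl
  | succ j => simp [serviceStart, h]

lemma serviceStart_succ {first : ℕ} {u : ℝ} {t b : ℕ → ℝ} {j : ℕ} (h : first ≤ j) :
    serviceStart first u t b (j + 1) = max (t (j + 1)) (departure first u t b j) := by
  simp [serviceStart, departure, Nat.not_le.2 (Nat.lt_succ_of_le h)]

lemma serviceStart_congr {first : ℕ} {u : ℝ} {t t' b : ℕ → ℝ} {j : ℕ}
    (h : ∀ p ≤ j, t p = t' p) : serviceStart first u t b j = serviceStart first u t' b j := by
  induction j with
  | zero => rfl
  | succ j ih => simp only [serviceStart, h (j + 1) le_rfl, ih fun p hp => h p (by omega)]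

lemma numInSystem_congr {first : ℕ} {u : ℝ} {t t' b : ℕ → ℝ} {j : ℕ}
    (h : ∀ p ≤ j, t p = t' p) : numInSystem first u t b j = numInSystem first u t' b j := by
  unfold numInSystem
  congr 1
  refine Finset.filter_congr fun p hp => ?_
  have hp := (Finset.mem_Icc.1 hp).2
  rw [departure, departure, serviceStart_congr fun q hq => h q (hq.trans hp), h j le_rfl]

/-- `hN` matters: with nobody present, `j + 1 - N` would be client `j + 1`, whose epoch is not
controlled by `h`. -/
lemma elapsed_congr {first : ℕ} {u : ℝ} {t t' b : ℕ → ℝ} {j : ℕ}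
    (h : ∀ p ≤ j, t p = t' p) (hN : 1 ≤ numInSystem first u t b j) :
    elapsed first u t b j = elapsed first u t' b j := by
  unfold elapsed
  rw [← numInSystem_congr h, h j le_rfl, serviceStart_congr fun q hq => h q (by omega)]

/-- The service times of the clients `first, …, n` are positive, and the one of client `first`
exceeds `u`. -/
structure IsServiceTimes (first n : ℕ) (u : ℝ) (b : ℕ → ℝ) : Prop where
  pos : ∀ j ∈ Set.Icc first n, 0 < b j
  lt_first : first ≤ n → u < b first

lemma departure_pos {first n : ℕ} {u : ℝ} {t b : ℕ → ℝ} (hb : IsServiceTimes first n u b)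
    {j : ℕ} (hj : first ≤ j) (hjn : j ≤ n) : 0 < departure first u t b j := by
  induction j, hj using Nat.le_induction with
  | base =>
    rw [departure, serviceStart_of_le le_rfl]
    linarith [hb.lt_first hjn]
  | succ j hj ih =>
    rw [departure, serviceStart_succ hj]
    have := hb.pos (j + 1) ⟨by omega, hjn⟩
    have := le_max_right (t (j + 1)) (departure first u t b j)
    linarith [ih (by omega)]

lemma lt_departure {first n : ℕ} {u : ℝ} {t b : ℕ → ℝ} (hb : IsServiceTimes first n u b)
    (ht : t first = 0) {j : ℕ} (hj : first ≤ j) (hjn : j ≤ n) : t j < departure first u t b j := by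
  rcases hj.eq_or_lt with rfl | hj
  · rw [ht]
    exact departure_pos hb le_rfl hjn
  · obtain ⟨j, rfl⟩ : ∃ p, j = p + 1 := ⟨j - 1, by omega⟩
    rw [departure, serviceStart_succ (by omega)]
    have := hb.pos (j + 1) ⟨by omega, hjn⟩
    linarith [le_max_left (t (j + 1)) (departure first u t b j)]

lemma one_le_numInSystem {first n : ℕ} {u : ℝ} {t b : ℕ → ℝ} (hb : IsServiceTimes first n u b)
    (ht : t first = 0) {j : ℕ} (hj : first ≤ j) (hjn : j ≤ n) :
    1 ≤ numInSystem first u t b j :=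
  Finset.card_pos.2 ⟨j, by simpa [hj] using lt_departure hb ht hj hjn⟩

lemma numInSystem_le {first : ℕ} {u : ℝ} {t b : ℕ → ℝ} {j : ℕ} :
    numInSystem first u t b j ≤ j + 1 - first := by
  simpa [numInSystem] using Finset.card_filter_le (Finset.Icc first j) _

lemma numInSystem_of_eq_zero {first n : ℕ} {u : ℝ} {t b : ℕ → ℝ}
    (hb : IsServiceTimes first n u b) {j : ℕ} (hjn : j ≤ n) (ht : t j = 0) :
    numInSystem first u t b j = j + 1 - first := by
  rw [numInSystem, Finset.filter_true_of_mem, Nat.card_Icc]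
  intro p hp
  rw [Finset.mem_Icc] at hp
  rw [ht]
  exact departure_pos hb hp.1 (by omega)

/-! ### Arrival epochs generated by a policy -/

/-- The arrival epochs from client `a + 1` on are those prescribed by the policy. -/
def Follows (π : Policy) (first n : ℕ) (u : ℝ) (b t : ℕ → ℝ) (a : ℕ) : Prop :=
  ∀ j, a ≤ j → j < n →
    t (j + 1) = t j + π.gap j (numInSystem first u t b j) (elapsed first u t b j)

lemma Follows.le {π : Policy} {first n : ℕ} {u : ℝ} {b t : ℕ → ℝ} {a : ℕ}
    (h : Follows π first n u b t a) {j : ℕ} (hj : a ≤ j) (hjn : j ≤ n) : t a ≤ t j := by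
  induction j, hj using Nat.le_induction with
  | base => exact le_rfl
  | succ j hj ih =>
    rw [h j hj (by omega)]
    exact (ih (by omega)).trans (le_add_of_nonneg_right (π.gap_nonneg _ _ _))

lemma arrival_of_le {i first : ℕ} {u : ℝ} {π : Policy} {b : ℕ → ℝ} (m : ℕ) {j : ℕ} (hj : j ≤ i) :
    arrival i first u π b m j = 0 := by
  induction m with
  | zero => rfl
  | succ m ih => rw [arrival, Function.update_of_ne (by omega), ih]

/-- Each update touches only the newest epoch, and earlier decisions depend only on earlier epochs.
Positivity of the service times ensures that somebody is present, as `elapsed_congr` requires. -/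
lemma follows_arrival {i first n : ℕ} {u : ℝ} {π : Policy} {b : ℕ → ℝ} (hfi : first ≤ i)
    (hb : IsServiceTimes first n u b) (m : ℕ) (hm : i + m ≤ n) :
    Follows π first (i + m) u b (arrival i first u π b m) i := by
  induction m with
  | zero => intro j h1 h2; omega
  | succ m ih =>
    intro j h1 h2
    set t := arrival i first u π b m with ht
    have hu : ∀ p ≤ i + m, t p = arrival i first u π b (m + 1) p := fun p hp => by
      rw [arrival, Function.update_of_ne (by omega)]
    have h0 : t first = 0 := arrival_of_le m hfi
    have hj : j ≤ i + m := by omega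
    rw [← numInSystem_congr fun p hp => hu p (hp.trans hj),
      ← elapsed_congr (fun p hp => hu p (hp.trans hj))
        (one_le_numInSystem hb h0 (hfi.trans h1) (by omega)), ← hu j hj]
    rcases hj.eq_or_lt with rfl | hj
    · exact Function.update_self ..
    · rw [← hu (j + 1) hj]
      exact ih (by omega) j h1 hj

/-- The cost incurred under the arrival epochs `t`. -/
noncomputable def pathCost (w : ℝ) (n i first : ℕ) (u : ℝ) (t b : ℕ → ℝ) : ℝ :=
  w * ∑ j ∈ Finset.Icc (i + 1) n, idle first u t b j +
    (1 - w) * ∑ j ∈ Finset.Icc first n, waiting first u t b j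

lemma pathCost_nonneg {w : ℝ} (hw : w ∈ Set.Icc (0 : ℝ) 1) (n i first : ℕ) (u : ℝ)
    (t b : ℕ → ℝ) : 0 ≤ pathCost w n i first u t b :=
  add_nonneg (mul_nonneg hw.1 (Finset.sum_nonneg fun _ _ => le_max_right _ _))
    (mul_nonneg (sub_nonneg.2 hw.2) (Finset.sum_nonneg fun _ _ => le_max_right _ _))

/-! ### Moving the time origin -/

/-- Arrival epochs after moving the time origin to `δ`. -/
def shift (δ : ℝ) (t : ℕ → ℝ) : ℕ → ℝ := fun j => max (t j - δ) 0

/-- Moving the time origin to `δ`, when client `first'` is in service and has been for `u'` time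
units. -/
structure IsShift (first n : ℕ) (u : ℝ) (t b : ℕ → ℝ) (first' : ℕ) (u' δ : ℝ) : Prop where
  times : IsServiceTimes first' n u' b
  first_le : first ≤ first'
  start_eq : first' ≤ n → serviceStart first u t b first' = δ - u'

namespace IsShift

variable {first n : ℕ} {u : ℝ} {t b : ℕ → ℝ} {first' : ℕ} {u' δ : ℝ}

/-- Cutting off past epochs at zero in `shift` is harmless: after the shift every departure of a
remaining client is positive, so the cutoff is absorbed by the maximum. -/
lemma serviceStart_eq (h : IsShift first n u t b first' u' δ) {j : ℕ} (hj : first' ≤ j)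
    (hjn : j ≤ n) :
    serviceStart first' u' (shift δ t) b j = serviceStart first u t b j - δ := by
  induction j, hj using Nat.le_induction with
  | base => rw [h.start_eq hjn, serviceStart_of_le le_rfl]; ring
  | succ j hj ih =>
    have hD := departure_pos (t := shift δ t) h.times hj (by omega)
    rw [serviceStart_succ hj, serviceStart_succ (h.first_le.trans hj), shift, max_assoc,
      max_eq_right hD.le, departure, ih (by omega), departure, ← max_sub_sub_right]
    congr 1
    ring

lemma departure_eq (h : IsShift first n u t b first' u' δ) {j : ℕ} (hj : first' ≤ j)
    (hjn : j ≤ n) : departure first' u' (shift δ t) b j = departure first u t b j - δ := by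
  rw [departure, h.serviceStart_eq hj hjn, departure]; ring

lemma lt_departure (h : IsShift first n u t b first' u' δ) {j : ℕ} (hj : first' ≤ j)
    (hjn : j ≤ n) : δ < departure first u t b j := by
  have := h.departure_eq hj hjn
  linarith [departure_pos (t := shift δ t) h.times hj hjn]

lemma lt_serviceStart (h : IsShift first n u t b first' u' δ) {j : ℕ} (hj : first' < j)
    (hjn : j ≤ n) : δ < serviceStart first u t b j := by
  obtain ⟨j, rfl⟩ : ∃ p, j = p + 1 := ⟨j - 1, by omega⟩
  have := h.first_le
  rw [serviceStart_succ (by omega)]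
  exact (h.lt_departure (by omega) (by omega)).trans_le (le_max_right _ _)

lemma waiting_eq (h : IsShift first n u t b first' u' δ) {j : ℕ} (hj : first' ≤ j)
    (hjn : j ≤ n) (htj : δ ≤ t j) :
    waiting first u t b j = waiting first' u' (shift δ t) b j := by
  rw [waiting, waiting, h.serviceStart_eq hj hjn, shift, max_eq_left (sub_nonneg.2 htj)]
  congr 1; ring

lemma waiting_eq_add (h : IsShift first n u t b first' u' δ) (hδ : 0 ≤ δ) {j : ℕ}
    (hj : first' ≤ j) (hjn : j ≤ n) (htj : t j = 0) (hS : δ ≤ serviceStart first u t b j) :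
    waiting first u t b j = waiting first' u' (shift δ t) b j + δ := by
  rw [waiting, waiting, h.serviceStart_eq hj hjn, shift, htj, max_eq_right (a := 0 - δ) (by linarith),
    max_eq_left (by linarith), max_eq_left (by linarith)]
  ring

lemma idle_eq (h : IsShift first n u t b first' u' δ) {j : ℕ} (hj : first' < j)
    (hjn : j ≤ n) (htj : δ ≤ t j) :
    idle first u t b j = idle first' u' (shift δ t) b j := by
  rw [idle, idle, h.departure_eq (by omega) (by omega), shift, max_eq_left (sub_nonneg.2 htj)]
  congr 1; ring

lemma numInSystem_eq (h : IsShift first n u t b first' u' δ) {j : ℕ}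
    (hjn : j ≤ n) (htj : δ ≤ t j)
    (hdep : ∀ p, first ≤ p → p < first' → departure first u t b p ≤ δ) :
    numInSystem first' u' (shift δ t) b j = numInSystem first u t b j := by
  unfold numInSystem
  congr 1
  ext p
  have h1 := h.first_le
  simp only [Finset.mem_filter, Finset.mem_Icc]
  by_cases hp : first' ≤ p
  · by_cases hpj : p ≤ j
    · rw [h.departure_eq hp (by omega), shift, max_eq_left (sub_nonneg.2 htj)]
      simp [hp, h1.trans hp]
    · simp [hpj]
  · constructor
    · intro hh; exact absurd hh.1.1 hp
    · rintro ⟨⟨h2, h3⟩, h4⟩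
      linarith [hdep p h2 (by omega)]

lemma elapsed_eq (h : IsShift first n u t b first' u' δ) {j : ℕ} (hj : first' ≤ j)
    (hjn : j < n) (htj : δ ≤ t j)
    (hdep : ∀ p, first ≤ p → p < first' → departure first u t b p ≤ δ) :
    elapsed first' u' (shift δ t) b j = elapsed first u t b j := by
  -- This bound yields `first' ≤ j + 1 - N`, so the client in service has not left before the new
  -- origin. The strict `hjn` keeps her index at most `n` even if `N = 0`.
  have h1 := numInSystem_le (first := first') (u := u') (t := shift δ t) (b := b) (j := j)
  unfold elapsed
  rw [h.numInSystem_eq hjn.le htj hdep] at h1 ⊢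
  rw [h.serviceStart_eq (by omega) (by omega), shift, max_eq_left (sub_nonneg.2 htj)]
  ring

/-- A policy has no access to absolute time, and both of its observations are invariant under the
shift. -/
lemma follows {π : Policy} (h : IsShift first n u t b first' u' δ) {a : ℕ}
    (hf : Follows π first n u b t a) (ha : first' ≤ a) (hta : δ ≤ t a)
    (hdep : ∀ p, first ≤ p → p < first' → departure first u t b p ≤ δ) :
    Follows π first' n u' b (shift δ t) a := by
  intro j hj hjn
  have htj := hta.trans (hf.le hj hjn.le)
  have htj' := hta.trans (hf.le (j := j + 1) (by omega) hjn)
  rw [h.numInSystem_eq hjn.le htj hdep, h.elapsed_eq (ha.trans hj) hjn htj hdep, shift, shift,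
    max_eq_left (sub_nonneg.2 htj'), max_eq_left (sub_nonneg.2 htj), hf j hj hjn]
  ring

end IsShift

/-! ### Splitting the cost at the next departure or arrival -/

lemma waiting_first {first i : ℕ} {u : ℝ} {t b : ℕ → ℝ} (hu : 0 ≤ u) (ht : ∀ j ≤ i, t j = 0)
    (hfi : first ≤ i) : waiting first u t b first = 0 := by
  rw [waiting, serviceStart_of_le le_rfl, ht _ hfi]
  exact max_eq_right (by linarith)

lemma sum_Ioc_waiting {first i n : ℕ} {u : ℝ} {t b : ℕ → ℝ} {first' : ℕ} {u' δ : ℝ}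
    (h : IsShift first n u t b first' u' δ) (hδ : 0 ≤ δ) (hf : first' ≤ first + 1)
    (hin : i ≤ n) (ht : ∀ j ≤ i, t j = 0) (ht' : ∀ j, i < j → j ≤ n → δ ≤ t j)
    (hS : ∀ j, first < j → j ≤ i → δ ≤ serviceStart first u t b j) :
    ∑ j ∈ Finset.Ioc first n, waiting first u t b j =
      ∑ j ∈ Finset.Ioc first n, waiting first' u' (shift δ t) b j + ((i - first : ℕ) : ℝ) * δ := by
  have h1 : ∑ j ∈ Finset.Ioc first n, (if j ≤ i then δ else 0) = ((i - first : ℕ) : ℝ) * δ := by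
    rw [← Finset.sum_filter, Finset.sum_const, nsmul_eq_mul]
    have : (Finset.Ioc first n).filter (· ≤ i) = Finset.Ioc first i := by
      ext j; simp only [Finset.mem_filter, Finset.mem_Ioc]; omega
    rw [this, Nat.card_Ioc]
  rw [← h1, ← Finset.sum_add_distrib]
  refine Finset.sum_congr rfl fun j hj => ?_
  rw [Finset.mem_Ioc] at hj
  split_ifs with hji
  · exact h.waiting_eq_add hδ (by omega) hj.2 (ht j hji) (hS j hj.1 hji)
  · rw [add_zero]
    exact h.waiting_eq (by omega) hj.2 (ht' j (by omega) hj.2)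

lemma sum_Icc_waiting {first i n : ℕ} {u : ℝ} {t b : ℕ → ℝ} (hu : 0 ≤ u) (ht : ∀ j ≤ i, t j = 0)
    (hfi : first ≤ i) (hin : i ≤ n) :
    ∑ j ∈ Finset.Icc first n, waiting first u t b j =
      ∑ j ∈ Finset.Ioc first n, waiting first u t b j := by
  rw [← Finset.add_sum_Ioc_eq_sum_Icc (hfi.trans hin), waiting_first hu ht hfi, zero_add]

lemma isShift_departure {first n : ℕ} {u : ℝ} {t b : ℕ → ℝ} (hb : IsServiceTimes first n u b)
    (ht : first + 1 ≤ n → t (first + 1) ≤ b first - u) :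
    IsShift first n u t b (first + 1) 0 (b first - u) where
  times := ⟨fun j hj => hb.pos j ⟨by have := hj.1; omega, hj.2⟩,
    fun h => hb.pos _ ⟨by omega, h⟩⟩
  first_le := by omega
  start_eq := fun h => by
    rw [serviceStart_succ le_rfl, departure, serviceStart_of_le le_rfl,
      max_eq_right (by linarith [ht h])]
    ring

lemma isShift_of_lt {first n : ℕ} {u τ : ℝ} {t b : ℕ → ℝ} (hb : IsServiceTimes first n u b)
    (hτ : τ < b first - u) :
    IsShift first n u t b first (u + τ) τ where
  times := ⟨hb.pos, fun _ => by linarith⟩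
  first_le := le_rfl
  start_eq := fun _ => by rw [serviceStart_of_le le_rfl]; ring

lemma isShift_empty {first n : ℕ} {u : ℝ} {t b : ℕ → ℝ} (hb : IsServiceTimes first n u b)
    (ht : b first - u ≤ t (first + 1)) :
    IsShift first n u t b (first + 1) 0 (t (first + 1)) where
  times := ⟨fun j hj => hb.pos j ⟨by have := hj.1; omega, hj.2⟩,
    fun h => hb.pos _ ⟨by omega, h⟩⟩
  first_le := by omega
  start_eq := fun h => by
    rw [serviceStart_succ le_rfl, departure, serviceStart_of_le le_rfl,
      max_eq_left (by linarith)]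
    ring

/-- The alternative `first < i ∨ i = n` excludes a departure that leaves the server idle before a
further arrival; `pathCost_empty` handles that case. -/
lemma pathCost_departure {w : ℝ} {first i n : ℕ} {u : ℝ} {t b : ℕ → ℝ} (hu : 0 ≤ u)
    (hb : IsServiceTimes first n u b) (hfi : first ≤ i) (hin : i ≤ n) (h : first < i ∨ i = n)
    (ht : ∀ j ≤ i, t j = 0) (ht' : ∀ j, i < j → j ≤ n → b first - u ≤ t j) :
    pathCost w n i first u t b = (1 - w) * (((i - first : ℕ) : ℝ) * (b first - u)) +
      pathCost w n i (first + 1) 0 (shift (b first - u) t) b := by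
  have hδ : 0 < b first - u := sub_pos.2 (hb.lt_first (by omega))
  have hs : IsShift first n u t b (first + 1) 0 (b first - u) := isShift_departure hb fun h1 => by
    rw [ht (first + 1) (by omega)]; exact hδ.le
  have hI : ∑ j ∈ Finset.Icc (i + 1) n, idle first u t b j =
      ∑ j ∈ Finset.Icc (i + 1) n, idle (first + 1) 0 (shift (b first - u) t) b j := by
    refine Finset.sum_congr rfl fun j hj => ?_
    rw [Finset.mem_Icc] at hj
    exact hs.idle_eq (by omega) hj.2 (ht' j (by omega) hj.2)
  have hW := sum_Ioc_waiting hs hδ.le le_rfl hin ht ht' fun j h1 h2 => by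
    rcases (Nat.succ_le_of_lt h1).eq_or_lt with rfl | h1
    · exact (hs.start_eq (by omega)).ge.trans' (by simp)
    · exact (hs.lt_serviceStart h1 (by omega)).le
  rw [pathCost, sum_Icc_waiting hu ht hfi hin, hW, hI, pathCost,
    Finset.Icc_add_one_left_eq_Ioc first n]
  ring

lemma pathCost_arrival {w : ℝ} {first i n : ℕ} {u : ℝ} {t b : ℕ → ℝ} (hu : 0 ≤ u)
    (hb : IsServiceTimes first n u b) (hfi : first ≤ i) (hin : i < n)
    (ht : ∀ j ≤ i, t j = 0) (hτ : 0 ≤ t (i + 1)) (ht' : ∀ j, i < j → j ≤ n → t (i + 1) ≤ t j)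
    (hlt : t (i + 1) < b first - u) :
    pathCost w n i first u t b = (1 - w) * (((i - first : ℕ) : ℝ) * t (i + 1)) +
      pathCost w n (i + 1) first (u + t (i + 1)) (shift (t (i + 1)) t) b := by
  have hs : IsShift first n u t b first (u + t (i + 1)) (t (i + 1)) := isShift_of_lt hb hlt
  have hI : ∑ j ∈ Finset.Icc (i + 1) n, idle first u t b j =
      ∑ j ∈ Finset.Icc (i + 1 + 1) n,
        idle first (u + t (i + 1)) (shift (t (i + 1)) t) b j := by
    rw [← Finset.add_sum_Ioc_eq_sum_Icc (by omega), idle, Nat.add_sub_cancel,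
      max_eq_right (sub_nonpos.2 (hs.lt_departure hfi hin.le).le), zero_add,
      ← Finset.Icc_add_one_left_eq_Ioc]
    refine Finset.sum_congr rfl fun j hj => ?_
    rw [Finset.mem_Icc] at hj
    exact hs.idle_eq (by omega) hj.2 (ht' j (by omega) hj.2)
  have hW := sum_Ioc_waiting hs hτ (by omega) hin.le ht ht' fun j h1 h2 =>
    (hs.lt_serviceStart h1 (by omega)).le
  have ht0 : ∀ j ≤ i + 1, shift (t (i + 1)) t j = 0 := by
    intro j hj
    rcases hj.eq_or_lt with rfl | hj
    · simp [shift]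
    · rw [shift, ht j (by omega)]; exact max_eq_right (by linarith)
  rw [pathCost, sum_Icc_waiting hu ht hfi hin.le, hW, hI, pathCost,
    sum_Icc_waiting (by linarith) ht0 (by omega) hin]
  ring

/-- The last departure and the idle period after it are treated as one event, since no client is in
service at an origin between them. -/
lemma pathCost_empty {w : ℝ} {i n : ℕ} {u : ℝ} {t b : ℕ → ℝ} (hu : 0 ≤ u)
    (hb : IsServiceTimes i n u b) (hin : i < n)
    (ht : ∀ j ≤ i, t j = 0) (hτ : 0 ≤ t (i + 1)) (ht' : ∀ j, i < j → j ≤ n → t (i + 1) ≤ t j)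
    (hle : b i - u ≤ t (i + 1)) :
    pathCost w n i i u t b = w * (t (i + 1) - (b i - u)) +
      pathCost w n (i + 1) (i + 1) 0 (shift (t (i + 1)) t) b := by
  have hs : IsShift i n u t b (i + 1) 0 (t (i + 1)) := isShift_empty hb hle
  have hI : ∑ j ∈ Finset.Icc (i + 1) n, idle i u t b j = (t (i + 1) - (b i - u)) +
      ∑ j ∈ Finset.Icc (i + 1 + 1) n, idle (i + 1) 0 (shift (t (i + 1)) t) b j := by
    rw [← Finset.add_sum_Ioc_eq_sum_Icc (by omega), idle, Nat.add_sub_cancel, departure,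
      serviceStart_of_le le_rfl, max_eq_left (by linarith), ← Finset.Icc_add_one_left_eq_Ioc]
    congr 1
    · ring
    refine Finset.sum_congr rfl fun j hj => ?_
    rw [Finset.mem_Icc] at hj
    exact hs.idle_eq (by omega) hj.2 (ht' j (by omega) hj.2)
  have hW := sum_Ioc_waiting hs hτ (by omega) hin.le ht ht' fun j h1 h2 => by omega
  rw [pathCost, sum_Icc_waiting hu ht le_rfl hin.le, hW, hI, pathCost,
    Finset.Icc_add_one_left_eq_Ioc i n, Nat.sub_self, Nat.cast_zero]
  ring

/-! ### The cost as a recursion over departures and arrivals -/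

/-- The cost from the arrival of the last client `n` on, with `k` clients present. -/
noncomputable def terminalCost (w : ℝ) (n : ℕ) : ℕ → ℝ → (ℕ → ℝ) → ℝ≥0∞
  | 0, _, _ => 0
  | k + 1, u, b => ENNReal.ofReal ((1 - w) * (k * (b (n - k) - u))) + terminalCost w n k 0 b

/-- The cost after the arrival of client `i`, with `k` clients present, if client `i + 1` arrives
after `τ` time units and `K` gives the cost from then on. -/
noncomputable def stepCost (w : ℝ) (K : ℕ → ℝ → (ℕ → ℝ) → ℝ≥0∞) (i : ℕ) :
    ℕ → ℝ → ℝ → (ℕ → ℝ) → ℝ≥0∞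
  | 0, _, τ, b => ENNReal.ofReal (w * τ) + K 1 0 b
  | k + 1, u, τ, b =>
    if b (i - k) - u ≤ τ then
      ENNReal.ofReal ((1 - w) * (k * (b (i - k) - u))) +
        stepCost w K i k 0 (τ - (b (i - k) - u)) b
    else ENNReal.ofReal ((1 - w) * (k * τ)) + K (k + 2) (u + τ) b

/-- The cost after the arrival of client `i` if `m` clients are still to come. -/
noncomputable def recCost (w : ℝ) (π : Policy) : ℕ → ℕ → ℕ → ℝ → (ℕ → ℝ) → ℝ≥0∞
  | 0, i, k, u, b => terminalCost w i k u b
  | m + 1, i, k, u, b => stepCost w (recCost w π m (i + 1)) i k u (π.gap i k u) b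

lemma ofReal_pathCost_terminal {w : ℝ} (hw : w ∈ Set.Icc (0 : ℝ) 1) {n : ℕ} {b : ℕ → ℝ} (k : ℕ)
    (hk : k ≤ n) {u : ℝ} (hu : 0 ≤ u) {t : ℕ → ℝ} (ht : ∀ j ≤ n, t j = 0)
    (hb : IsServiceTimes (n + 1 - k) n u b) :
    ENNReal.ofReal (pathCost w n n (n + 1 - k) u t b) = terminalCost w n k u b := by
  induction k generalizing u t with
  | zero => simp [pathCost, terminalCost]
  | succ k ih =>
    have h1 : n + 1 - (k + 1) = n - k := by omega
    have h2 : n + 1 - k = n - k + 1 := by omega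
    have h3 : n - (n - k) = k := by omega
    rw [h1] at hb ⊢
    rw [h2] at ih
    have hδ : 0 < b (n - k) - u := sub_pos.2 (hb.lt_first (by omega))
    rw [pathCost_departure hu hb (by omega) le_rfl (Or.inr rfl) ht (by omega), h3, terminalCost,
      ENNReal.ofReal_add (mul_nonneg (sub_nonneg.2 hw.2) (by positivity))
        (pathCost_nonneg hw ..), ih (by omega) le_rfl]
    · intro j hj
      rw [shift, ht j hj]
      exact max_eq_right (by linarith)
    · refine (isShift_departure (t := t) hb fun h => ?_).times
      rw [ht _ h]; exact hδ.le

/-- Induction on the clients waiting behind the one in service: a departure removes one of them, an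
arrival hands over to `K`. Keeping `K` abstract separates this induction from the one over arrivals.
-/
lemma ofReal_pathCost_step {w : ℝ} (hw : w ∈ Set.Icc (0 : ℝ) 1) {π : Policy} {i n : ℕ}
    {b : ℕ → ℝ} {K : ℕ → ℝ → (ℕ → ℝ) → ℝ≥0∞} (hin : i < n)
    (hK : ∀ (l : ℕ) (v : ℝ) (t : ℕ → ℝ), 1 ≤ l → l ≤ i + 1 → 0 ≤ v → (∀ j ≤ i + 1, t j = 0) →
      IsServiceTimes (i + 2 - l) n v b → Follows π (i + 2 - l) n v b t (i + 1) →
      ENNReal.ofReal (pathCost w n (i + 1) (i + 2 - l) v t b) = K l v b)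
    (k : ℕ) (hk : k + 1 ≤ i) {u : ℝ} (hu : 0 ≤ u) {t : ℕ → ℝ} (ht : ∀ j ≤ i, t j = 0)
    (hτ : 0 ≤ t (i + 1)) (hb : IsServiceTimes (i - k) n u b)
    (hf : Follows π (i - k) n u b t (i + 1)) :
    ENNReal.ofReal (pathCost w n i (i - k) u t b) =
      stepCost w K i (k + 1) u (t (i + 1)) b := by
  induction k generalizing u t with
  | zero =>
    simp only [Nat.sub_zero, zero_add, stepCost] at hb hf ⊢
    have ht' : ∀ j, i < j → j ≤ n → t (i + 1) ≤ t j := fun j h1 h2 => hf.le h1 h2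
    have h0 : ∀ j ≤ i + 1, shift (t (i + 1)) t j = 0 := by
      intro j hj
      rcases hj.eq_or_lt with rfl | hj
      · simp [shift]
      · rw [shift, ht j (by omega)]; exact max_eq_right (by linarith)
    split_ifs with hs
    · have hsh := isShift_empty (t := t) hb hs
      rw [pathCost_empty hu hb hin ht hτ ht' hs,
        ENNReal.ofReal_add (mul_nonneg hw.1 (sub_nonneg.2 hs)) (pathCost_nonneg hw ..)]
      rw [← hK 1 0 (shift (t (i + 1)) t) le_rfl (by omega) le_rfl h0 hsh.times]
      · simp
      refine hsh.follows hf le_rfl le_rfl fun p h1 h2 => ?_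
      obtain rfl : p = i := by omega
      rw [departure, serviceStart_of_le le_rfl]
      linarith
    · rw [not_le] at hs
      have hsh := isShift_of_lt (t := t) hb hs
      rw [pathCost_arrival hu hb le_rfl hin ht hτ ht' hs,
        ← hK 2 (u + t (i + 1)) (shift (t (i + 1)) t) (by omega) (by omega) (by linarith) h0
          hsh.times (hsh.follows hf (by omega) le_rfl (by omega))]
      simp
  | succ k ih =>
    have h1 : i - k = i - (k + 1) + 1 := by omega
    have h3 : i - (i - (k + 1)) = k + 1 := by omega
    have ht' : ∀ j, i < j → j ≤ n → t (i + 1) ≤ t j := fun j h1 h2 => hf.le h1 h2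
    rw [stepCost]
    have hδ : 0 < b (i - (k + 1)) - u := sub_pos.2 (hb.lt_first (by omega))
    have hw' := sub_nonneg.2 hw.2
    split_ifs with hs
    · have hsh : IsShift (i - (k + 1)) n u t b (i - (k + 1) + 1) 0 (b (i - (k + 1)) - u) :=
        isShift_departure hb fun h => by rw [ht _ (by omega)]; exact hδ.le
      have hst : shift (b (i - (k + 1)) - u) t (i + 1) = t (i + 1) - (b (i - (k + 1)) - u) :=
        max_eq_left (sub_nonneg.2 hs)
      rw [h1] at ih
      rw [pathCost_departure hu hb (by omega) hin.le (Or.inl (by omega)) ht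
        (fun j h1 h2 => hs.trans (ht' j h1 h2)), h3,
        ENNReal.ofReal_add (by positivity) (pathCost_nonneg hw ..), ih (by omega) le_rfl, hst]
      · intro j hj
        rw [shift, ht j hj]
        exact max_eq_right (by linarith)
      · rw [hst]; linarith
      · exact hsh.times
      · refine hsh.follows hf (by omega) hs fun p h1 h2 => ?_
        obtain rfl : p = i - (k + 1) := by omega
        rw [departure, serviceStart_of_le le_rfl]
        linarith
    · rw [not_le] at hs
      have hsh := isShift_of_lt (t := t) hb hs
      have h0 : ∀ j ≤ i + 1, shift (t (i + 1)) t j = 0 := by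
        intro j hj
        rcases hj.eq_or_lt with rfl | hj
        · simp [shift]
        · rw [shift, ht j (by omega)]; exact max_eq_right (by linarith)
      have h4 : i + 2 - (k + 1 + 2) = i - (k + 1) := by omega
      rw [pathCost_arrival hu hb (by omega) hin ht hτ ht' hs, h3,
        ENNReal.ofReal_add (by positivity) (pathCost_nonneg hw ..),
        ← hK (k + 1 + 2) (u + t (i + 1)) (shift (t (i + 1)) t) (by omega) (by omega) (by linarith) h0
          (h4 ▸ hsh.times) (h4 ▸ hsh.follows hf (by omega) le_rfl (by omega)), h4]

/-- Since all epochs up to client `i` are zero, she finds everyone from `i + 1 - k` on still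
present. The policy therefore reads exactly `k` and `u`, and its decision is `π.gap i k u`. -/
lemma ofReal_pathCost {w : ℝ} (hw : w ∈ Set.Icc (0 : ℝ) 1) {π : Policy} {n : ℕ} {b : ℕ → ℝ}
    (m : ℕ) {i k : ℕ} (him : i + m = n) (hk1 : 1 ≤ k) (hki : k ≤ i) {u : ℝ} (hu : 0 ≤ u)
    {t : ℕ → ℝ} (ht : ∀ j ≤ i, t j = 0) (hb : IsServiceTimes (i + 1 - k) n u b)
    (hf : Follows π (i + 1 - k) n u b t i) :
    ENNReal.ofReal (pathCost w n i (i + 1 - k) u t b) = recCost w π m i k u b := by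
  induction m generalizing i k u t with
  | zero =>
    obtain rfl : i = n := by omega
    rw [recCost]
    exact ofReal_pathCost_terminal hw k hki hu ht hb
  | succ m ih =>
    obtain ⟨k, rfl⟩ : ∃ p, k = p + 1 := ⟨k - 1, by omega⟩
    have h1 : i + 1 - (k + 1) = i - k := by omega
    rw [h1] at hb hf ⊢
    have hN : numInSystem (i - k) u t b i = k + 1 := by
      rw [numInSystem_of_eq_zero hb (by omega) (ht i le_rfl)]
      omega
    have hE : elapsed (i - k) u t b i = u := by
      rw [elapsed, hN, serviceStart_of_le (by omega), ht i le_rfl]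
      ring
    have hg := hf i le_rfl (by omega)
    rw [hN, hE, ht i le_rfl, zero_add] at hg
    rw [recCost, ← hg]
    refine ofReal_pathCost_step (π := π) hw (by omega) ?_ k hki hu ht
      (hg ▸ π.gap_nonneg _ _ _) hb (fun j hj hjn => hf j (by omega) hjn)
    intro l v t' hl1 hl2 hv ht' hb' hf'
    exact ih (by omega) hl1 hl2 hv ht' hb' hf'

lemma ofReal_cost {w : ℝ} (hw : w ∈ Set.Icc (0 : ℝ) 1) {π : Policy} {b : ℕ → ℝ}
    {m i k : ℕ} (hk1 : 1 ≤ k) (hki : k ≤ i) {u : ℝ} (hu : 0 ≤ u)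
    (hb : IsServiceTimes (i + 1 - k) (i + m) u b) :
    ENNReal.ofReal (cost w (i + m) i k u π b) = recCost w π m i k u b := by
  rw [← ofReal_pathCost hw m rfl hk1 hki hu (fun j hj => arrival_of_le m hj) hb
    (follows_arrival (by omega) hb m le_rfl), cost, Nat.add_sub_cancel_left]
  rfl

/-! ### Poisson probabilities -/

/-- `ℙ(Pois(r) = j)`. -/
noncomputable def poissonTerm (j : ℕ) (r : ℝ) : ℝ := Real.exp (-r) * r ^ j / (j.factorial : ℝ)

/-- `ℙ(Pois(r) < m)`. -/
noncomputable def poissonSum (m : ℕ) (r : ℝ) : ℝ := ∑ j ∈ Finset.range m, poissonTerm j r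

lemma poissonSum_zero (r : ℝ) : poissonSum 0 r = 0 := rfl

lemma poissonSum_succ (m : ℕ) (r : ℝ) :
    poissonSum (m + 1) r = poissonSum m r + poissonTerm m r := Finset.sum_range_succ ..

lemma hasDerivAt_poissonTerm_zero (r : ℝ) :
    HasDerivAt (poissonTerm 0) (-poissonTerm 0 r) r := by
  have h := (hasDerivAt_neg r).exp
  refine (h.congr_of_eventuallyEq (.of_forall fun x => ?_)).congr_deriv ?_ <;> simp [poissonTerm]

lemma hasDerivAt_poissonTerm_succ (j : ℕ) (r : ℝ) :
    HasDerivAt (poissonTerm (j + 1)) (poissonTerm j r - poissonTerm (j + 1) r) r := by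
  have h := (((hasDerivAt_neg r).exp.mul (hasDerivAt_pow (j + 1) r)).div_const
    ((j + 1).factorial : ℝ))
  refine h.congr_deriv ?_
  have : (j.factorial : ℝ) ≠ 0 := by positivity
  have : (j : ℝ) + 1 ≠ 0 := by positivity
  simp only [poissonTerm, Nat.factorial_succ, Nat.cast_mul, Nat.cast_add_one, Nat.add_sub_cancel]
  field_simp
  ring

/-- The derivatives of the terms telescope. -/
lemma hasDerivAt_poissonSum (m : ℕ) (r : ℝ) :
    HasDerivAt (poissonSum (m + 1)) (-poissonTerm m r) r := by
  induction m with
  | zero =>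
    refine (hasDerivAt_poissonTerm_zero r).congr_of_eventuallyEq (.of_forall fun x => ?_)
    simp [poissonSum]
  | succ m ih =>
    refine ((ih.add (hasDerivAt_poissonTerm_succ m r)).congr_of_eventuallyEq
      (.of_forall fun x => poissonSum_succ ..)).congr_deriv ?_
    ring

/-- Stating the cutoff as an equivalence also covers negative `j`, with `m = 0`; this reconciles the
integer `k - 2` with the truncated natural `k - 1`. -/
lemma poissonCDF_eq {r : ℝ} (hr : 0 ≤ r) {m : ℕ} {j : ℤ} (hj : ∀ p : ℕ, (p : ℤ) ≤ j ↔ p < m) :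
    poissonCDF r j = poissonSum m r := by
  have h : {p : ℕ | (p : ℤ) ≤ j} = (Finset.range m : Set ℕ) := by
    ext p; simp [hj]
  rw [poissonCDF, h, ← sum_measureReal_singleton]
  refine Finset.sum_congr rfl fun p _ => ?_
  rw [poissonMeasure_real_singleton, Real.coe_toNNReal _ hr, poissonTerm]

lemma trans_one {μ t : ℝ} (h : 0 ≤ μ * t) (k : ℕ) :
    trans μ k 1 t = 1 - poissonSum k (μ * t) := by
  have hs := hasSum_one_poissonMeasure (μ * t).toNNReal
  rw [Real.coe_toNNReal _ h] at hs
  have := hs.summable.sum_add_tsum_nat_add k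
  rw [hs.tsum_eq] at this
  rw [trans, if_pos rfl, eq_sub_iff_add_eq, ← this, add_comm]
  simp only [poissonSum, poissonTerm, add_comm k]

/-- Reindexing by the number `j = k + 1 - l` of departures before the arrival; `l = 1` collects the
tail in which the system empties. -/
lemma sum_trans {μ t : ℝ} (h : 0 ≤ μ * t) (k : ℕ) (c : ℕ → ℝ) :
    ∑ l ∈ Finset.Icc 1 (k + 1), trans μ k l t * c l =
      (1 - poissonSum k (μ * t)) * c 1 +
        ∑ j ∈ Finset.range k, poissonTerm j (μ * t) * c (k + 1 - j) := by
  rw [← Finset.add_sum_Ioc_eq_sum_Icc (by omega), trans_one h]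
  congr 1
  refine Finset.sum_bij' (fun l _ => k + 1 - l) (fun j _ => k + 1 - j) ?_ ?_ ?_ ?_ ?_
  all_goals intro l hl
  all_goals simp only [Finset.mem_Ioc, Finset.mem_range] at hl ⊢
  any_goals omega
  rw [trans, if_neg (by omega), poissonTerm, show k + 1 - (k + 1 - l) = l by omega]

/-! ### The right-hand side of the recursion -/

/-- The expected idle time, as a smooth function of `t`. -/
noncomputable def idleValue (μ : ℝ) (k : ℕ) (t : ℝ) : ℝ :=
  t * (1 - poissonSum k (μ * t)) - k / μ * (1 - poissonSum (k + 1) (μ * t))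

/-- The expected total waiting time, as a smooth function of `t`. -/
noncomputable def waitValue (μ : ℝ) (k : ℕ) (t : ℝ) : ℝ :=
  ((k : ℝ) - 1) * t * poissonSum k (μ * t) - μ * t ^ 2 / 2 * poissonSum (k - 1) (μ * t)
    + (k : ℝ) * ((k : ℝ) - 1) / (2 * μ) * (1 - poissonSum (k + 1) (μ * t))

/-- The expectation of `c` at the number of clients just after the next arrival. -/
noncomputable def transValue (μ : ℝ) (c : ℕ → ℝ) (k : ℕ) (t : ℝ) : ℝ :=
  (1 - poissonSum k (μ * t)) * c 1 + ∑ j ∈ Finset.range k, poissonTerm j (μ * t) * c (k + 1 - j)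

/-- The expected cost if the next client arrives after `t` time units and `c` gives the expected
cost from then on. -/
noncomputable def stepValue (μ w : ℝ) (c : ℕ → ℝ) (k : ℕ) (t : ℝ) : ℝ :=
  w * idleValue μ k t + (1 - w) * waitValue μ k t + transValue μ c k t

lemma idleTerm_eq {μ t : ℝ} (h : 0 ≤ μ * t) (k : ℕ) : idleTerm μ k t = idleValue μ k t := by
  rw [idleTerm, idleValue, poissonCDF_eq h (m := k) (by omega),
    poissonCDF_eq h (m := k + 1) (by omega)]

lemma waitTerm_eq {μ t : ℝ} (h : 0 ≤ μ * t) (k : ℕ) : waitTerm μ k t = waitValue μ k t := by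
  rw [waitTerm, waitValue, poissonCDF_eq h (m := k) (by omega),
    poissonCDF_eq h (m := k - 1) (by omega), poissonCDF_eq h (m := k + 1) (by omega)]

lemma stepValue_eq {μ t : ℝ} (h : 0 ≤ μ * t) (w : ℝ) (c : ℕ → ℝ) (k : ℕ) :
    w * idleTerm μ k t + (1 - w) * waitTerm μ k t +
      ∑ l ∈ Finset.Icc 1 (k + 1), trans μ k l t * c l = stepValue μ w c k t := by
  rw [idleTerm_eq h, waitTerm_eq h, sum_trans h, stepValue, transValue]

lemma hasDerivAt_comp_mul {f : ℝ → ℝ} {f' μ t : ℝ} (h : HasDerivAt f f' (μ * t)) :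
    HasDerivAt (fun t => f (μ * t)) (μ * f') t := by
  have := h.comp t ((hasDerivAt_id t).const_mul μ)
  simpa [Function.comp_def, mul_comm] using this

/-- Backward equation: at rate `μ` the first departure turns `k + 1` clients into `k`. The same
equation without source term holds for `transValue`. -/
lemma hasDerivAt_idleValue {μ : ℝ} (hμ : μ ≠ 0) (k : ℕ) (t : ℝ) :
    HasDerivAt (idleValue μ (k + 1)) (μ * (idleValue μ k t - idleValue μ (k + 1) t)) t := by
  have h1 := hasDerivAt_comp_mul (hasDerivAt_poissonSum k (μ * t))
  have h2 := hasDerivAt_comp_mul (hasDerivAt_poissonSum (k + 1) (μ * t))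
  have h := ((hasDerivAt_id t).mul (h1.const_sub 1)).sub
    ((h2.const_sub 1).const_mul (((k + 1 : ℕ) : ℝ) / μ))
  refine h.congr_deriv ?_
  simp only [idleValue, poissonSum_succ, id_eq]
  push_cast
  field_simp
  ring

lemma hasDerivAt_transValue {μ : ℝ} (c : ℕ → ℝ) (k : ℕ) (t : ℝ) :
    HasDerivAt (transValue μ c (k + 1))
      (μ * (transValue μ c k t - transValue μ c (k + 1) t)) t := by
  have h1 := hasDerivAt_comp_mul (hasDerivAt_poissonSum k (μ * t))
  have h0 := hasDerivAt_comp_mul (hasDerivAt_poissonTerm_zero (μ * t))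
  have h2 := HasDerivAt.fun_sum (u := Finset.range k) fun j _ =>
    (hasDerivAt_comp_mul (hasDerivAt_poissonTerm_succ j (μ * t))).mul_const (c (k + 1 + 1 - (j + 1)))
  have h := ((h1.const_sub 1).mul_const (c 1)).add (h2.add (h0.mul_const (c (k + 1 + 1 - 0))))
  refine (h.congr_of_eventuallyEq (.of_forall fun x => ?_)).congr_deriv ?_
  · simp only [transValue, Finset.sum_range_succ', Pi.add_apply]
  · simp only [transValue, Finset.sum_range_succ', poissonSum_succ, sub_mul, mul_sub, mul_add,
      Finset.sum_sub_distrib, mul_assoc, ← Finset.mul_sum, Nat.add_sub_add_right]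
    ring

/-- The source term `k` is the rate at which the clients behind the one in service accumulate
waiting time. -/
lemma hasDerivAt_waitValue {μ : ℝ} (hμ : μ ≠ 0) (k : ℕ) (t : ℝ) :
    HasDerivAt (waitValue μ (k + 1)) (μ * (waitValue μ k t - waitValue μ (k + 1) t) + k) t := by
  have h1 := hasDerivAt_comp_mul (hasDerivAt_poissonSum k (μ * t))
  have h2 := hasDerivAt_comp_mul (hasDerivAt_poissonSum (k + 1) (μ * t))
  have ht : HasDerivAt (fun t : ℝ => (((k + 1 : ℕ) : ℝ) - 1) * t) (((k + 1 : ℕ) : ℝ) - 1) t := by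
    simpa using (hasDerivAt_id t).const_mul (((k + 1 : ℕ) : ℝ) - 1)
  have ht2 : HasDerivAt (fun t : ℝ => μ * t ^ 2 / 2) (μ * t) t := by
    refine (((hasDerivAt_pow 2 t).const_mul μ).div_const 2).congr_deriv ?_
    simp; ring
  -- For `k = 0` the middle Poisson sum is the empty one, to which `hasDerivAt_poissonSum` does not
  -- apply.
  cases k with
  | zero =>
    have h := ((ht.mul h1).sub (ht2.mul (hasDerivAt_const t (0 : ℝ)))).add
      ((h2.const_sub 1).const_mul (((0 + 1 : ℕ) : ℝ) * (((0 + 1 : ℕ) : ℝ) - 1) / (2 * μ)))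
    refine h.congr_deriv ?_
    simp [waitValue, poissonSum_zero]
  | succ k =>
    have h3 := hasDerivAt_comp_mul (hasDerivAt_poissonSum k (μ * t))
    have h := ((ht.mul h1).sub (ht2.mul h3)).add
      ((h2.const_sub 1).const_mul
        (((k + 1 + 1 : ℕ) : ℝ) * (((k + 1 + 1 : ℕ) : ℝ) - 1) / (2 * μ)))
    refine h.congr_deriv ?_
    simp only [waitValue, poissonSum_succ, Nat.add_sub_cancel]
    push_cast
    field_simp
    ring

/-! ### The exponential distribution -/

/-- The two densities differ only at the null point `0`. -/
lemma expMeasure_eq (μ : ℝ) : expMeasure μ =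
    (volume.restrict (Set.Ioi 0)).withDensity fun x => ENNReal.ofReal (μ * Real.exp (-(μ * x))) := by
  rw [← withDensity_indicator measurableSet_Ioi]
  change volume.withDensity (exponentialPDF μ) = _
  refine withDensity_congr_ae ?_
  filter_upwards [Measure.ae_ne volume (0 : ℝ)] with x hx
  rw [exponentialPDF_eq]
  rcases hx.lt_or_gt with h | h
  · rw [Set.indicator_of_notMem (by simpa using h.le), if_neg (not_le.2 h), ENNReal.ofReal_zero]
  · rw [Set.indicator_of_mem (Set.mem_Ioi.2 h), if_pos h.le]

lemma ae_pos_expMeasure (μ : ℝ) : ∀ᵐ x ∂expMeasure μ, 0 < x := by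
  rw [expMeasure_eq]
  exact (withDensity_absolutelyContinuous _ _).ae_le (ae_restrict_mem measurableSet_Ioi)

/-- The density is measurable and finite, so `f` may be arbitrary; measurability of `stepMean` in
its time argument is thus never needed. -/
lemma setLIntegral_expMeasure {μ : ℝ} {s : Set ℝ} (hs : MeasurableSet s) (f : ℝ → ℝ≥0∞) :
    ∫⁻ x in s, f x ∂expMeasure μ =
      ∫⁻ x in s ∩ Set.Ioi 0, ENNReal.ofReal (μ * Real.exp (-(μ * x))) * f x := by
  rw [expMeasure_eq, restrict_withDensity hs, Measure.restrict_restrict hs,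
    lintegral_withDensity_eq_lintegral_mul_non_measurable _ (by fun_prop)
      (.of_forall fun _ => ENNReal.ofReal_lt_top)]
  rfl

lemma lintegral_expMeasure {μ : ℝ} (f : ℝ → ℝ≥0∞) :
    ∫⁻ x, f x ∂expMeasure μ =
      ∫⁻ x in Set.Ioi 0, ENNReal.ofReal (μ * Real.exp (-(μ * x))) * f x := by
  rw [← setLIntegral_univ, setLIntegral_expMeasure .univ, Set.univ_inter]

lemma setLIntegral_Ioi_expMeasure_aux {μ τ : ℝ} (hτ : 0 ≤ τ) (f : ℝ → ℝ≥0∞) :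
    ∫⁻ x in Set.Ioi τ, f x ∂expMeasure μ =
      ENNReal.ofReal (Real.exp (-(μ * τ))) * ∫⁻ x, f (τ + x) ∂expMeasure μ := by
  rw [setLIntegral_expMeasure measurableSet_Ioi, lintegral_expMeasure,
    Set.inter_eq_left.2 (Set.Ioi_subset_Ioi hτ), ← lintegral_const_mul' _ _ ENNReal.ofReal_ne_top,
    ← lintegral_indicator measurableSet_Ioi, ← lintegral_indicator measurableSet_Ioi,
    ← lintegral_add_left_eq_self _ τ]
  refine lintegral_congr fun x => ?_
  by_cases hx : 0 < x
  · rw [Set.indicator_of_mem (by simpa using hx), Set.indicator_of_mem (by simpa using hx),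
      ← mul_assoc, ← ENNReal.ofReal_mul (Real.exp_pos _).le, mul_left_comm, ← Real.exp_add]
    ring_nf
  · rw [Set.indicator_of_notMem (by simpa using hx), Set.indicator_of_notMem (by simpa using hx)]

lemma expMeasure_Ioi {μ τ : ℝ} (hμ : 0 < μ) (hτ : 0 ≤ τ) :
    expMeasure μ (Set.Ioi τ) = ENNReal.ofReal (Real.exp (-(μ * τ))) := by
  have := isProbabilityMeasure_expMeasure hμ
  simpa using setLIntegral_Ioi_expMeasure_aux (μ := μ) hτ 1

/-- Memorylessness. -/
lemma setLIntegral_Ioi_expMeasure {μ τ : ℝ} (hμ : 0 < μ) (hτ : 0 ≤ τ) (f : ℝ → ℝ≥0∞) :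
    ∫⁻ x in Set.Ioi τ, f x ∂expMeasure μ =
      expMeasure μ (Set.Ioi τ) * ∫⁻ x, f (τ + x) ∂expMeasure μ := by
  rw [expMeasure_Ioi hμ hτ, setLIntegral_Ioi_expMeasure_aux hτ]

/-! ### The expected cost until the next arrival -/

/-- The expectation of the cost until the next arrival, `τ` time units ahead, plus the value of `c`
at the number of clients just after it, as a recursion over departures. -/
noncomputable def stepMean (μ w : ℝ) (c : ℕ → ℝ≥0∞) : ℕ → ℝ → ℝ≥0∞
  | 0, τ => ENNReal.ofReal (w * τ) + c 1
  | k + 1, τ =>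
    ∫⁻ x in Set.Iic τ, (ENNReal.ofReal ((1 - w) * (k * x)) + stepMean μ w c k (τ - x)) ∂expMeasure μ
      + expMeasure μ (Set.Ioi τ) * (ENNReal.ofReal ((1 - w) * (k * τ)) + c (k + 2))

/-- The value of `c` is collected once, with total probability one, so raising it by `ε` costs at
most `ε`. -/
lemma stepMean_add {μ w : ℝ} (hμ : 0 < μ) (c : ℕ → ℝ≥0∞) (ε : ℝ≥0∞) (k : ℕ) (τ : ℝ) :
    stepMean μ w (fun l => c l + ε) k τ ≤ stepMean μ w c k τ + ε := by
  have := isProbabilityMeasure_expMeasure hμ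
  induction k generalizing τ with
  | zero => simp only [stepMean, add_assoc, le_refl]
  | succ k ih =>
    simp only [stepMean]
    calc _ ≤ ∫⁻ x in Set.Iic τ, (ENNReal.ofReal ((1 - w) * (k * x)) + stepMean μ w c k (τ - x) + ε)
              ∂expMeasure μ
            + (expMeasure μ (Set.Ioi τ) * (ENNReal.ofReal ((1 - w) * (k * τ)) + c (k + 2)) +
              expMeasure μ (Set.Ioi τ) * ε) := by
          refine add_le_add (lintegral_mono fun x => ?_) ?_
          · rw [add_assoc]
            gcongr
            exact ih _
          · rw [← mul_add, add_assoc]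
      _ = ∫⁻ x in Set.Iic τ, (ENNReal.ofReal ((1 - w) * (k * x)) + stepMean μ w c k (τ - x))
              ∂expMeasure μ
            + expMeasure μ (Set.Ioi τ) * (ENNReal.ofReal ((1 - w) * (k * τ)) + c (k + 2))
            + ε * (expMeasure μ (Set.Iic τ) + expMeasure μ (Set.Ioi τ)) := by
          rw [lintegral_add_right _ measurable_const, setLIntegral_const, mul_add ε,
            mul_comm (expMeasure μ _) ε]
          abel
      _ = _ := by
          rw [← Set.compl_Iic, measure_add_measure_compl measurableSet_Iic, measure_univ, mul_one]

/-! ### The closed form of the one-step mean -/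

lemma hasDerivAt_stepValue {μ : ℝ} (hμ : μ ≠ 0) (w : ℝ) (c : ℕ → ℝ) (k : ℕ) (t : ℝ) :
    HasDerivAt (stepValue μ w c (k + 1))
      (μ * (stepValue μ w c k t - stepValue μ w c (k + 1) t) + (1 - w) * k) t := by
  refine ((((hasDerivAt_idleValue hμ k t).const_mul w).add
    ((hasDerivAt_waitValue hμ k t).const_mul (1 - w))).add
      (hasDerivAt_transValue c k t)).congr_deriv ?_
  simp only [stepValue]
  ring

lemma stepValue_zero (μ w : ℝ) (c : ℕ → ℝ) (t : ℝ) : stepValue μ w c 0 t = w * t + c 1 := by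
  simp [stepValue, idleValue, waitValue, transValue, poissonSum_zero]

lemma poissonSum_succ_zero (m : ℕ) : poissonSum (m + 1) 0 = 1 := by
  rw [poissonSum, Finset.sum_range_succ']
  simp [poissonTerm]

lemma stepValue_succ_zero (μ w : ℝ) (c : ℕ → ℝ) (k : ℕ) :
    stepValue μ w c (k + 1) 0 = c (k + 2) := by
  simp [stepValue, idleValue, waitValue, transValue, poissonSum_succ_zero, Finset.sum_range_succ',
    poissonTerm]

lemma continuous_stepValue {μ : ℝ} (hμ : μ ≠ 0) (w : ℝ) (c : ℕ → ℝ) (k : ℕ) :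
    Continuous (stepValue μ w c k) := by
  cases k with
  | zero =>
    simp only [funext (stepValue_zero μ w c)]
    fun_prop
  | succ k =>
    exact continuous_iff_continuousAt.2 fun t => (hasDerivAt_stepValue hμ w c k t).continuousAt

lemma integral_stepValue {μ : ℝ} (hμ : μ ≠ 0) (w : ℝ) (c : ℕ → ℝ) (k : ℕ) (τ : ℝ) :
    ∫ x in (0 : ℝ)..τ, μ * Real.exp (-(μ * x)) * ((1 - w) * (k * x) + stepValue μ w c k (τ - x)) =
      stepValue μ w c (k + 1) τ - Real.exp (-(μ * τ)) * ((1 - w) * (k * τ) + c (k + 2)) := by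
  have hc := continuous_stepValue hμ w c k
  -- Variation of constants: by the backward equation the terms with `k + 1` clients cancel in the
  -- derivative, leaving the integrand with `k`.
  have h : ∀ x ∈ Set.uIcc 0 τ, HasDerivAt
      (fun x => -(Real.exp (-(μ * x)) * ((1 - w) * (k * x) + stepValue μ w c (k + 1) (τ - x))))
      (μ * Real.exp (-(μ * x)) * ((1 - w) * (k * x) + stepValue μ w c k (τ - x))) x := by
    intro x _
    have h1 : HasDerivAt (fun x => Real.exp (-(μ * x))) (Real.exp (-(μ * x)) * -μ) x := by
      simpa using ((hasDerivAt_id x).const_mul μ).neg.exp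
    have h2 : HasDerivAt (fun x : ℝ => (1 - w) * (k * x)) ((1 - w) * k) x := by
      simpa using ((hasDerivAt_id x).const_mul (k : ℝ)).const_mul (1 - w)
    have h3 := (hasDerivAt_stepValue hμ w c k (τ - x)).comp_const_sub τ x
    refine (h1.mul (h2.add h3)).neg.congr_deriv ?_
    simp only [Pi.add_apply]
    ring
  rw [intervalIntegral.integral_eq_sub_of_hasDerivAt h
    (Continuous.intervalIntegrable (by fun_prop) _ _)]
  simp [stepValue_succ_zero]
  ring

/-- Nonnegativity is carried through the induction because `ENNReal.ofReal` is additive only on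
nonnegative reals. -/
lemma stepMean_eq {μ w : ℝ} (hμ : 0 < μ) (hw : w ∈ Set.Icc (0 : ℝ) 1) {c : ℕ → ℝ}
    (hc : ∀ l, 0 ≤ c l) (k : ℕ) {τ : ℝ} (hτ : 0 ≤ τ) :
    0 ≤ stepValue μ w c k τ ∧
      stepMean μ w (fun l => ENNReal.ofReal (c l)) k τ = ENNReal.ofReal (stepValue μ w c k τ) := by
  have hw' := sub_nonneg.2 hw.2
  have hw0 := hw.1
  induction k generalizing τ with
  | zero =>
    have := hc 1
    rw [stepValue_zero, stepMean, ENNReal.ofReal_add (by positivity) this]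
    exact ⟨by positivity, rfl⟩
  | succ k ih =>
    have hint := integral_stepValue hμ.ne' w c k τ
    have hck := hc (k + 2)
    have hnn : ∀ x ∈ Set.Ioc 0 τ, 0 ≤ (1 - w) * (k * x) + stepValue μ w c k (τ - x) := by
      intro x hx
      have := hx.1.le
      have := (ih (sub_nonneg.2 hx.2)).1
      positivity
    have hnn' : ∀ x ∈ Set.Ioc 0 τ,
        0 ≤ μ * Real.exp (-(μ * x)) * ((1 - w) * (k * x) + stepValue μ w c k (τ - x)) :=
      fun x hx => mul_nonneg (by positivity) (hnn x hx)
    have hI : 0 ≤ ∫ x in (0 : ℝ)..τ,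
        μ * Real.exp (-(μ * x)) * ((1 - w) * (k * x) + stepValue μ w c k (τ - x)) := by
      rw [intervalIntegral.integral_of_le hτ]
      exact setIntegral_nonneg measurableSet_Ioc hnn'
    have hE : 0 ≤ Real.exp (-(μ * τ)) * ((1 - w) * (k * τ) + c (k + 2)) := by positivity
    have heq : stepValue μ w c (k + 1) τ = (∫ x in (0 : ℝ)..τ,
        μ * Real.exp (-(μ * x)) * ((1 - w) * (k * x) + stepValue μ w c k (τ - x))) +
          Real.exp (-(μ * τ)) * ((1 - w) * (k * τ) + c (k + 2)) := by
      rw [hint]; ring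
    refine ⟨by rw [heq]; positivity, ?_⟩
    rw [heq, ENNReal.ofReal_add hI hE, stepMean, expMeasure_Ioi hμ hτ,
      ENNReal.ofReal_mul (Real.exp_pos _).le, ENNReal.ofReal_add (by positivity) hck]
    congr 1
    have hcont := continuous_stepValue hμ.ne' w c k
    rw [setLIntegral_expMeasure measurableSet_Iic, Set.Iic_inter_Ioi,
      intervalIntegral.integral_of_le hτ, ofReal_integral_eq_lintegral_ofReal]
    · refine setLIntegral_congr_fun measurableSet_Ioc fun x hx => ?_
      have h1 := ih (sub_nonneg.2 hx.2)
      have := hx.1.le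
      rw [h1.2, ← ENNReal.ofReal_add (by positivity) h1.1, ← ENNReal.ofReal_mul (by positivity)]
    · refine (Continuous.integrableOn_Icc ?_).mono_set Set.Ioc_subset_Icc_self
      fun_prop
    · exact (ae_restrict_iff' measurableSet_Ioc).2 (.of_forall hnn')

section

/-! ### Measurability and locality of the recursive cost -/

lemma measurable_terminalCost (w : ℝ) (n k : ℕ) :
    Measurable fun p : ℝ × (ℕ → ℝ) => terminalCost w n k p.1 p.2 := by
  induction k with
  | zero => exact measurable_const
  | succ k ih =>
    have h : Measurable fun p : ℝ × (ℕ → ℝ) => ((0 : ℝ), p.2) := by fun_prop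
    have := ih.comp h
    simp only [terminalCost]
    exact Measurable.add (by fun_prop) this

lemma measurable_stepCost {w : ℝ} {K : ℕ → ℝ → (ℕ → ℝ) → ℝ≥0∞}
    (hK : ∀ l, Measurable fun p : ℝ × (ℕ → ℝ) => K l p.1 p.2) (i k : ℕ) :
    Measurable fun p : ℝ × ℝ × (ℕ → ℝ) => stepCost w K i k p.1 p.2.1 p.2.2 := by
  induction k with
  | zero =>
    have h : Measurable fun p : ℝ × ℝ × (ℕ → ℝ) => ((0 : ℝ), p.2.2) := by fun_prop
    have := (hK 1).comp h
    simp only [stepCost]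
    exact Measurable.add (by fun_prop) this
  | succ k ih =>
    have h1 : Measurable fun p : ℝ × ℝ × (ℕ → ℝ) =>
        ((0 : ℝ), p.2.1 - (p.2.2 (i - k) - p.1), p.2.2) := by fun_prop
    have h2 : Measurable fun p : ℝ × ℝ × (ℕ → ℝ) => (p.1 + p.2.1, p.2.2) := by fun_prop
    have h3 := ih.comp h1
    have h4 := (hK (k + 2)).comp h2
    simp only [stepCost]
    refine Measurable.ite (measurableSet_le (by fun_prop) (by fun_prop)) ?_ ?_
    · exact Measurable.add (by fun_prop) h3
    · exact Measurable.add (by fun_prop) h4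

lemma measurable_recCost (w : ℝ) (π : Policy) (m i k : ℕ) :
    Measurable fun p : ℝ × (ℕ → ℝ) => recCost w π m i k p.1 p.2 := by
  induction m generalizing i k with
  | zero => exact measurable_terminalCost w i k
  | succ m ih =>
    have hg := π.measurable_gap i k
    have h : Measurable fun p : ℝ × (ℕ → ℝ) => (p.1, π.gap i k p.1, p.2) := by fun_prop
    exact (measurable_stepCost (w := w) (fun l => ih (i + 1) l) i k).comp h

lemma terminalCost_congr {w : ℝ} {n k : ℕ} (hk : k ≤ n) (u : ℝ) {b b' : ℕ → ℝ}
    (h : ∀ j ∈ Set.Icc (n + 1 - k) n, b j = b' j) :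
    terminalCost w n k u b = terminalCost w n k u b' := by
  induction k generalizing u with
  | zero => rfl
  | succ k ih =>
    rw [terminalCost, terminalCost, h (n - k) ⟨by omega, by omega⟩,
      ih (by omega) 0 fun j hj => h j ⟨by have := hj.1; omega, hj.2⟩]

lemma stepCost_congr {w : ℝ} {K : ℕ → ℝ → (ℕ → ℝ) → ℝ≥0∞} {i n k : ℕ} (hin : i < n)
    {b b' : ℕ → ℝ}
    (hK : ∀ l v, 1 ≤ l → l ≤ k + 1 → (∀ j ∈ Set.Icc (i + 2 - l) n, b j = b' j) →
      K l v b = K l v b')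
    (hk : k ≤ i) (u τ : ℝ) (h : ∀ j ∈ Set.Icc (i + 1 - k) n, b j = b' j) :
    stepCost w K i k u τ b = stepCost w K i k u τ b' := by
  induction k generalizing u τ with
  | zero => rw [stepCost, stepCost, hK 1 0 le_rfl (by omega) h]
  | succ k ih =>
    have hb := h (i - k) ⟨by omega, by omega⟩
    simp only [stepCost, hb]
    rw [ih (fun l v h1 h2 => hK l v h1 (by omega)) (by omega) _ _
        fun j hj => h j ⟨by have := hj.1; omega, hj.2⟩,
      hK (k + 2) _ (by omega) (by omega) fun j hj => h j ⟨by have := hj.1; omega, hj.2⟩]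

/-- Service times of departed clients no longer matter; this is what allows them to be integrated
out one at a time. -/
lemma recCost_congr {w : ℝ} {π : Policy} {m i k : ℕ} (hk : k ≤ i) (u : ℝ) {b b' : ℕ → ℝ}
    (h : ∀ j ∈ Set.Icc (i + 1 - k) (i + m), b j = b' j) :
    recCost w π m i k u b = recCost w π m i k u b' := by
  induction m generalizing i k u with
  | zero => exact terminalCost_congr hk u h
  | succ m ih =>
    refine stepCost_congr (n := i + (m + 1)) (by omega) (fun l v h1 h2 h3 => ?_) hk u _ h
    exact ih (by omega) v (by rwa [add_right_comm i 1 m])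

/-! ### Integrating out one service time -/

/-- Under `Q`, the coordinates `1, …, n` are exponential with rate `μ` and independent of all other
coordinates. -/
def IsExpSequence (μ : ℝ) (n : ℕ) (Q : Measure (ℕ → ℝ)) : Prop :=
  ∀ j ∈ Set.Icc 1 n, ∀ F : (ℕ → ℝ) → ℝ≥0∞, Measurable F →
    ∫⁻ b, F b ∂Q = ∫⁻ b, ∫⁻ x, F (Function.update b j x) ∂expMeasure μ ∂Q

/-- The expectation of `G` if client `j` has elapsed service time `u`. -/
noncomputable def residualMean (Q : Measure (ℕ → ℝ)) (G : (ℕ → ℝ) → ℝ≥0∞) (j : ℕ) (u : ℝ) :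
    ℝ≥0∞ := ∫⁻ b, G (Function.update b j (u + b j)) ∂Q

lemma residualMean_zero (Q : Measure (ℕ → ℝ)) (G : (ℕ → ℝ) → ℝ≥0∞) (j : ℕ) :
    residualMean Q G j 0 = ∫⁻ b, G b ∂Q := by simp [residualMean]

lemma measurable_update_pair (j : ℕ) (u : ℝ) :
    Measurable fun p : (ℕ → ℝ) × ℝ => Function.update p.1 j (u + p.2) := by
  refine measurable_pi_iff.2 fun a => ?_
  by_cases h : a = j
  · subst h
    simp only [Function.update_self]
    fun_prop
  · simp only [Function.update_of_ne h]
    fun_prop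

variable {μ : ℝ} {n : ℕ} {Q : Measure (ℕ → ℝ)}

lemma IsExpSequence.residualMean_eq (hQ : IsExpSequence μ n Q) {j : ℕ} (hj : j ∈ Set.Icc 1 n)
    {G : (ℕ → ℝ) → ℝ≥0∞} (hG : Measurable G) (u : ℝ) :
    residualMean Q G j u = ∫⁻ b, ∫⁻ x, G (Function.update b j (u + x)) ∂expMeasure μ ∂Q := by
  rw [residualMean, hQ j hj]
  · simp
  · refine hG.comp ((measurable_update_pair j u).comp (g := fun p : (ℕ → ℝ) × ℝ => _)
      (f := fun b => (b, b j)) (by fun_prop))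

lemma IsExpSequence.residualMean_eq' [IsProbabilityMeasure Q] (hμ : 0 < μ)
    (hQ : IsExpSequence μ n Q) {j : ℕ} (hj : j ∈ Set.Icc 1 n)
    {G : (ℕ → ℝ) → ℝ≥0∞} (hG : Measurable G) (u : ℝ) :
    residualMean Q G j u = ∫⁻ x, ∫⁻ b, G (Function.update b j (u + x)) ∂Q ∂expMeasure μ := by
  have := isProbabilityMeasure_expMeasure hμ
  rw [hQ.residualMean_eq hj hG, lintegral_lintegral_swap]
  exact (hG.comp (measurable_update_pair j u)).aemeasurable

/-- Split on the residual service time `x` of the client in service: she leaves before the arrival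
if `x ≤ τ`; otherwise memorylessness renews her residual with elapsed time `u + τ`. -/
lemma IsExpSequence.residualMean_stepCost [IsProbabilityMeasure Q] (hμ : 0 < μ)
    (hQ : IsExpSequence μ n Q) {w : ℝ} {K : ℕ → ℝ → (ℕ → ℝ) → ℝ≥0∞}
    (hK : ∀ l, Measurable fun p : ℝ × (ℕ → ℝ) => K l p.1 p.2) {i k : ℕ} (hin : i < n)
    (hK' : ∀ l v b b', 1 ≤ l → l ≤ i + 1 → (∀ j ∈ Set.Icc (i + 2 - l) n, b j = b' j) →
      K l v b = K l v b')
    (hk : k + 1 ≤ i) (u : ℝ) {τ : ℝ} (hτ : 0 ≤ τ) :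
    residualMean Q (stepCost w K i (k + 1) u τ) (i - k) u =
      ∫⁻ x in Set.Iic τ, (ENNReal.ofReal ((1 - w) * (k * x)) +
          residualMean Q (stepCost w K i k 0 (τ - x)) (i + 1 - k) 0) ∂expMeasure μ
        + expMeasure μ (Set.Ioi τ) * (ENNReal.ofReal ((1 - w) * (k * τ)) +
          residualMean Q (K (k + 2) (u + τ)) (i - k) (u + τ)) := by
  have := isProbabilityMeasure_expMeasure hμ
  have hj : i - k ∈ Set.Icc 1 n := ⟨by omega, by omega⟩
  have hG : Measurable (stepCost w K i (k + 1) u τ) :=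
    (measurable_stepCost hK i (k + 1)).comp
      (f := fun b : ℕ → ℝ => ((u, τ, b) : ℝ × ℝ × (ℕ → ℝ))) (by fun_prop)
  have hG' : Measurable (K (k + 2) (u + τ)) :=
    (hK (k + 2)).comp (f := fun b : ℕ → ℝ => ((u + τ, b) : ℝ × (ℕ → ℝ))) (by fun_prop)
  rw [hQ.residualMean_eq' hμ hj hG, ← lintegral_add_compl _ (measurableSet_Iic (a := τ)),
    Set.compl_Iic]
  congr 1
  · refine setLIntegral_congr_fun measurableSet_Iic fun x hx => ?_
    have h : ∀ b : ℕ → ℝ, stepCost w K i (k + 1) u τ (Function.update b (i - k) (u + x)) =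
        ENNReal.ofReal ((1 - w) * (k * x)) + stepCost w K i k 0 (τ - x) b := by
      intro b
      rw [stepCost, Function.update_self, add_sub_cancel_left, if_pos (Set.mem_Iic.1 hx)]
      congr 1
      refine stepCost_congr hin (fun l v h1 h2 => hK' l v _ _ h1 (by omega)) (by omega) _ _
        fun j hj => Function.update_of_ne ?_ ..
      have := hj.1
      omega
    simp only [h]
    rw [lintegral_add_left measurable_const, residualMean_zero, lintegral_const, measure_univ,
      mul_one]
  · have h : ∀ x ∈ Set.Ioi τ,
        ∫⁻ b, stepCost w K i (k + 1) u τ (Function.update b (i - k) (u + x)) ∂Q =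
        ENNReal.ofReal ((1 - w) * (k * τ)) +
          ∫⁻ b, K (k + 2) (u + τ) (Function.update b (i - k) (u + x)) ∂Q := by
      intro x hx
      simp only [stepCost, Function.update_self, add_sub_cancel_left, if_neg (not_le.2 (Set.mem_Ioi.1 hx))]
      rw [lintegral_add_left measurable_const, lintegral_const, measure_univ, mul_one]
    rw [setLIntegral_congr_fun measurableSet_Ioi h, setLIntegral_Ioi_expMeasure hμ hτ,
      lintegral_add_left measurable_const, lintegral_const, measure_univ, mul_one,
      hQ.residualMean_eq' hμ hj hG']
    simp only [add_assoc]

/-- Both sides satisfy the same recursion over departures, so bounds on the continuation propagate.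
For `k = 0` the index `i + 1 - k` is a client yet to arrive, hence the requirement `u = 0`. -/
lemma IsExpSequence.stepMean_le [IsProbabilityMeasure Q] (hμ : 0 < μ)
    (hQ : IsExpSequence μ n Q) {w : ℝ} {K : ℕ → ℝ → (ℕ → ℝ) → ℝ≥0∞}
    (hK : ∀ l, Measurable fun p : ℝ × (ℕ → ℝ) => K l p.1 p.2) {i : ℕ} (hin : i < n)
    (hK' : ∀ l v b b', 1 ≤ l → l ≤ i + 1 → (∀ j ∈ Set.Icc (i + 2 - l) n, b j = b' j) →
      K l v b = K l v b') {c : ℕ → ℝ≥0∞}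
    (hc : ∀ l v, 1 ≤ l → l ≤ i + 1 → 0 ≤ v → c l ≤ residualMean Q (K l v) (i + 2 - l) v)
    {k : ℕ} (hk : k ≤ i) {u τ : ℝ} (hu : 0 ≤ u) (hu0 : k = 0 → u = 0) (hτ : 0 ≤ τ) :
    stepMean μ w c k τ ≤ residualMean Q (stepCost w K i k u τ) (i + 1 - k) u := by
  induction k generalizing u τ with
  | zero =>
    have h1 := hc 1 0 le_rfl (by omega) le_rfl
    rw [residualMean_zero] at h1
    rw [hu0 rfl, residualMean_zero]
    simp only [stepCost, stepMean]
    rw [lintegral_add_left measurable_const, lintegral_const, measure_univ, mul_one]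
    gcongr
  | succ k ih =>
    rw [Nat.add_sub_add_right, hQ.residualMean_stepCost hμ hK hin hK' hk u hτ, stepMean]
    refine add_le_add (setLIntegral_mono' measurableSet_Iic fun x hx => ?_) ?_
    · gcongr
      exact ih (by omega) le_rfl (fun _ => rfl) (sub_nonneg.2 hx)
    · have := hc (k + 2) (u + τ) (by omega) (by omega) (by positivity)
      rw [Nat.add_sub_add_right] at this
      gcongr

lemma IsExpSequence.le_stepMean [IsProbabilityMeasure Q] (hμ : 0 < μ)
    (hQ : IsExpSequence μ n Q) {w : ℝ} {K : ℕ → ℝ → (ℕ → ℝ) → ℝ≥0∞}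
    (hK : ∀ l, Measurable fun p : ℝ × (ℕ → ℝ) => K l p.1 p.2) {i : ℕ} (hin : i < n)
    (hK' : ∀ l v b b', 1 ≤ l → l ≤ i + 1 → (∀ j ∈ Set.Icc (i + 2 - l) n, b j = b' j) →
      K l v b = K l v b') {c : ℕ → ℝ≥0∞}
    (hc : ∀ l v, 1 ≤ l → l ≤ i + 1 → 0 ≤ v → residualMean Q (K l v) (i + 2 - l) v ≤ c l)
    {k : ℕ} (hk : k ≤ i) {u τ : ℝ} (hu : 0 ≤ u) (hu0 : k = 0 → u = 0) (hτ : 0 ≤ τ) :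
    residualMean Q (stepCost w K i k u τ) (i + 1 - k) u ≤ stepMean μ w c k τ := by
  induction k generalizing u τ with
  | zero =>
    have h1 := hc 1 0 le_rfl (by omega) le_rfl
    rw [residualMean_zero] at h1
    rw [hu0 rfl, residualMean_zero]
    simp only [stepCost, stepMean]
    rw [lintegral_add_left measurable_const, lintegral_const, measure_univ, mul_one]
    gcongr
  | succ k ih =>
    rw [Nat.add_sub_add_right, hQ.residualMean_stepCost hμ hK hin hK' hk u hτ, stepMean]
    refine add_le_add (setLIntegral_mono' measurableSet_Iic fun x hx => ?_) ?_
    · gcongr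
      exact ih (by omega) le_rfl (fun _ => rfl) (sub_nonneg.2 hx)
    · have := hc (k + 2) (u + τ) (by omega) (by omega) (by positivity)
      rw [Nat.add_sub_add_right] at this
      gcongr

lemma lintegral_id_expMeasure (hμ : 0 < μ) {a : ℝ} (ha : 0 ≤ a) :
    ∫⁻ x, ENNReal.ofReal (a * x) ∂expMeasure μ = ENNReal.ofReal (a / μ) := by
  have h1 : ∫⁻ x, ENNReal.ofReal x ∂expMeasure μ =
      ∫⁻ t in Set.Ioi 0, expMeasure μ {x | t < x} :=
    lintegral_eq_lintegral_meas_lt _ ((ae_pos_expMeasure μ).mono fun x hx => hx.le)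
      measurable_id.aemeasurable
  -- The integral of the survival function is read off from the total mass of the density, which is
  -- `μ` times it.
  have h2 : ∫⁻ x, (1 : ℝ≥0∞) ∂expMeasure μ = 1 := by
    have := isProbabilityMeasure_expMeasure hμ
    simp
  rw [lintegral_expMeasure] at h2
  simp only [ENNReal.ofReal_mul hμ.le, mul_one] at h2
  rw [lintegral_const_mul' _ _ ENNReal.ofReal_ne_top] at h2
  have h3 : ∫⁻ t in Set.Ioi 0, expMeasure μ {x | t < x} =
      ∫⁻ t in Set.Ioi (0 : ℝ), ENNReal.ofReal (Real.exp (-(μ * t))) :=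
    setLIntegral_congr_fun measurableSet_Ioi fun t ht => expMeasure_Ioi hμ (le_of_lt ht)
  simp only [ENNReal.ofReal_mul ha]
  rw [lintegral_const_mul' _ _ ENNReal.ofReal_ne_top, h1, h3, ENNReal.ofReal_div_of_pos hμ,
    div_eq_mul_inv]
  congr 1
  exact ENNReal.eq_inv_of_mul_eq_one_left (by rwa [mul_comm])

/-- With `k` clients behind the one in service, her residual time has mean `1 / μ` and costs `(1 -
w) * k / μ`; summation gives the triangular number. -/
lemma IsExpSequence.residualMean_terminalCost [IsProbabilityMeasure Q] (hμ : 0 < μ)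
    (hQ : IsExpSequence μ n Q) {w : ℝ} (hw : w ≤ 1) {k : ℕ} (hk : k ≤ n) {u : ℝ} :
    residualMean Q (terminalCost w n k u) (n + 1 - k) u =
      ENNReal.ofReal ((1 - w) * (k * (k - 1) / (2 * μ))) := by
  have := isProbabilityMeasure_expMeasure hμ
  have hw' := sub_nonneg.2 hw
  induction k generalizing u with
  | zero => simp [residualMean, terminalCost]
  | succ k ih =>
    have hj : n - k ∈ Set.Icc 1 n := ⟨by omega, by omega⟩
    have hG : Measurable (terminalCost w n (k + 1) u) :=
      (measurable_terminalCost w n (k + 1)).comp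
        (f := fun b : ℕ → ℝ => ((u, b) : ℝ × (ℕ → ℝ))) (by fun_prop)
    have h : ∀ (x : ℝ) (b : ℕ → ℝ),
        terminalCost w n (k + 1) u (Function.update b (n - k) (u + x)) =
        ENNReal.ofReal ((1 - w) * k * x) + terminalCost w n k 0 b := by
      intro x b
      rw [terminalCost, Function.update_self, add_sub_cancel_left, mul_assoc]
      congr 1
      refine terminalCost_congr (by omega) _ fun j hj => Function.update_of_ne ?_ ..
      have := hj.1
      omega
    have h0 := ih (by omega) (u := 0)
    rw [residualMean_zero] at h0
    rw [Nat.add_sub_add_right, hQ.residualMean_eq' hμ hj hG]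
    simp only [h]
    have hk1 : (0 : ℝ) ≤ k * (k - 1) := by
      rcases Nat.eq_zero_or_pos k with rfl | hk
      · simp
      · have : (1 : ℝ) ≤ k := by exact_mod_cast hk
        exact mul_nonneg (by positivity) (by linarith)
    simp_rw [lintegral_add_left measurable_const, h0]
    rw [lintegral_add_right _ measurable_const]
    simp only [lintegral_const, measure_univ, mul_one]
    rw [lintegral_id_expMeasure hμ (by positivity), ← ENNReal.ofReal_add (by positivity)
      (by positivity)]
    congr 1
    push_cast
    field_simp
    ring

end

section

/-! ### The value function -/

/-- The value function of the recursion, when `m` clients are still to come. -/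
noncomputable def optCost (μ w : ℝ) : ℕ → ℕ → ℝ≥0∞
  | 0, k => ENNReal.ofReal ((1 - w) * (k * (k - 1) / (2 * μ)))
  | m + 1, k => ⨅ t : {t : ℝ // 0 ≤ t}, stepMean μ w (optCost μ w m) k t

variable {μ w : ℝ}

/-- The gap `0` already has finite cost. -/
lemma optCost_ne_top (hμ : 0 < μ) (hw : w ∈ Set.Icc (0 : ℝ) 1) (m k : ℕ) :
    optCost μ w m k ≠ ⊤ := by
  induction m generalizing k with
  | zero => exact ENNReal.ofReal_ne_top
  | succ m ih =>
    refine ((iInf_le _ ⟨0, le_rfl⟩).trans_lt ?_).ne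
    have h := (stepMean_eq hμ hw (c := fun l => (optCost μ w m l).toReal)
      (fun _ => ENNReal.toReal_nonneg) k le_rfl).2
    simp only [ENNReal.ofReal_toReal (ih _)] at h
    rw [h]
    exact ENNReal.ofReal_lt_top

lemma stepMean_optCost (hμ : 0 < μ) (hw : w ∈ Set.Icc (0 : ℝ) 1) (m k : ℕ) {t : ℝ} (ht : 0 ≤ t) :
    0 ≤ stepValue μ w (fun l => (optCost μ w m l).toReal) k t ∧
    stepMean μ w (optCost μ w m) k t =
      ENNReal.ofReal (stepValue μ w (fun l => (optCost μ w m l).toReal) k t) := by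
  have h := stepMean_eq hμ hw (c := fun l => (optCost μ w m l).toReal)
    (fun _ => ENNReal.toReal_nonneg) k ht
  simp only [ENNReal.ofReal_toReal (optCost_ne_top hμ hw m _)] at h
  exact h

lemma isGLB_optCost (hμ : 0 < μ) (hw : w ∈ Set.Icc (0 : ℝ) 1) (m k : ℕ) :
    IsGLB (stepValue μ w (fun l => (optCost μ w m l).toReal) k '' Set.Ici 0)
      (optCost μ w (m + 1) k).toReal := by
  constructor
  · rintro _ ⟨t, ht, rfl⟩
    have h := stepMean_optCost hμ hw m k ht
    refine ENNReal.toReal_le_of_le_ofReal h.1 ?_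
    rw [← h.2]
    exact iInf_le (fun t : {t : ℝ // 0 ≤ t} => stepMean μ w (optCost μ w m) k t) ⟨t, ht⟩
  · intro x hx
    rw [← ENNReal.ofReal_le_iff_le_toReal (optCost_ne_top hμ hw _ _)]
    refine le_iInf fun t => ?_
    rw [(stepMean_optCost hμ hw m k t.2).2]
    exact ENNReal.ofReal_le_ofReal (hx ⟨t, t.2, rfl⟩)

variable {Q : Measure (ℕ → ℝ)} [IsProbabilityMeasure Q]

/-- The gap chosen by `π` is one competitor in the infimum, and the later costs are bounded by
induction. -/
lemma IsExpSequence.optCost_le (hμ : 0 < μ) (hw : w ≤ 1) {m i k : ℕ}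
    (hQ : IsExpSequence μ (i + m) Q) (hk1 : 1 ≤ k) (hki : k ≤ i) {u : ℝ} (hu : 0 ≤ u)
    (π : Policy) :
    optCost μ w m k ≤ residualMean Q (recCost w π m i k u) (i + 1 - k) u := by
  induction m generalizing i k u with
  | zero => exact (hQ.residualMean_terminalCost hμ hw hki).ge
  | succ m ih =>
    have hQ' : IsExpSequence μ (i + 1 + m) Q := by rwa [add_right_comm i 1 m]
    refine (iInf_le _ ⟨π.gap i k u, π.gap_nonneg _ _ _⟩).trans ?_
    exact hQ.stepMean_le hμ (fun l => measurable_recCost w π m (i + 1) l) (by omega)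
      (fun l v b b' _ h2 h3 => recCost_congr h2 v (by rwa [add_right_comm i 1 m]))
      (fun l v h1 h2 hv => ih hQ' h1 h2 hv) hki hu (by omega) (π.gap_nonneg _ _ _)

lemma exists_stepMean_le (hμ : 0 < μ) (hw : w ∈ Set.Icc (0 : ℝ) 1) (m k : ℕ) {ε : ℝ≥0∞}
    (hε : ε ≠ 0) :
    ∃ t, 0 ≤ t ∧ stepMean μ w (optCost μ w m) k t ≤ optCost μ w (m + 1) k + ε := by
  have h : ⨅ t : {t : ℝ // 0 ≤ t}, stepMean μ w (optCost μ w m) k t <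
      optCost μ w (m + 1) k + ε :=
    ENNReal.lt_add_right (optCost_ne_top hμ hw (m + 1) k) hε
  obtain ⟨t, ht⟩ := iInf_lt_iff.1 h
  exact ⟨t, t.2, ht.le⟩

/-- A nearly optimal policy, which ignores the elapsed service time. -/
lemma exists_policy (hμ : 0 < μ) (hw : w ∈ Set.Icc (0 : ℝ) 1) (n : ℕ) {ε : ℝ≥0∞} (hε : ε ≠ 0) :
    ∃ π : Policy, ∀ m i k u, i + (m + 1) = n →
      stepMean μ w (optCost μ w m) k (π.gap i k u) ≤ optCost μ w (m + 1) k + ε := by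
  -- At client `j`, the number still to come after client `j + 1` is `n - j - 1`.
  choose τ h0 h using fun m k => exists_stepMean_le hμ hw m k hε
  refine ⟨⟨fun j N _ => τ (n - j - 1) N, fun j N _ => h0 _ _, fun j N => measurable_const⟩, ?_⟩
  intro m i k u hn
  obtain rfl : m = n - i - 1 := by omega
  exact h _ _

/-- Each of the `m` remaining decisions loses at most `ε`, and `stepMean_add` carries the later
losses through the current step. -/
lemma IsExpSequence.le_optCost (hμ : 0 < μ) (hw : w ≤ 1) {ε : ℝ≥0∞} {n : ℕ} {π : Policy}
    (hπ : ∀ m i k u, i + (m + 1) = n →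
      stepMean μ w (optCost μ w m) k (π.gap i k u) ≤ optCost μ w (m + 1) k + ε)
    {m i k : ℕ} (hn : i + m = n)
    (hQ : IsExpSequence μ n Q) (hk1 : 1 ≤ k) (hki : k ≤ i) {u : ℝ} (hu : 0 ≤ u) :
    residualMean Q (recCost w π m i k u) (i + 1 - k) u ≤ optCost μ w m k + m * ε := by
  induction m generalizing i k u with
  | zero =>
    obtain rfl : i = n := hn
    exact (hQ.residualMean_terminalCost hμ hw hki).le.trans le_self_add
  | succ m ih =>
    calc _ ≤ stepMean μ w (fun l => optCost μ w m l + m * ε) k (π.gap i k u) :=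
          hQ.le_stepMean hμ (fun l => measurable_recCost w π m (i + 1) l) (by omega)
            (fun l v b b' _ h2 h3 => recCost_congr h2 v
              (by rwa [show i + 1 + m = n by omega]))
            (fun l v h1 h2 hv => ih (by omega) h1 h2 hv) hki hu (by omega) (π.gap_nonneg _ _ _)
      _ ≤ stepMean μ w (optCost μ w m) k (π.gap i k u) + m * ε := stepMean_add hμ _ _ _ _
      _ ≤ optCost μ w (m + 1) k + ε + m * ε := by gcongr; exact hπ m i k u hn
      _ = _ := by push_cast; ring

lemma IsExpSequence.iInf_residualMean (hμ : 0 < μ) (hw : w ∈ Set.Icc (0 : ℝ) 1) {m i k : ℕ}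
    (hQ : IsExpSequence μ (i + m) Q) (hk1 : 1 ≤ k) (hki : k ≤ i) {u : ℝ} (hu : 0 ≤ u) :
    ⨅ π : Policy, residualMean Q (recCost w π m i k u) (i + 1 - k) u = optCost μ w m k := by
  refine le_antisymm ?_ (le_iInf fun π => hQ.optCost_le hμ hw.2 hk1 hki hu π)
  refine ENNReal.le_of_forall_pos_le_add fun ε hε _ => ?_
  have hε' : (ε : ℝ≥0∞) / (m + 1) ≠ 0 :=
    (ENNReal.div_pos (by exact_mod_cast hε.ne') (by finiteness)).ne'
  obtain ⟨π, hπ⟩ := exists_policy hμ hw (i + m) hε'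
  refine (iInf_le _ π).trans ((hQ.le_optCost hμ hw.2 hπ rfl hk1 hki hu).trans ?_)
  gcongr
  calc (m : ℝ≥0∞) * (ε / (m + 1)) ≤ (m + 1) * (ε / (m + 1)) := by gcongr; exact le_self_add
    _ ≤ ε := ENNReal.mul_div_le

/-! ### The law of the service times -/

variable {Ω : Type*} [MeasurableSpace Ω] {P : Measure Ω} {B : ℕ → Ω → ℝ} {n : ℕ}

/-- The service times of the clients `1, …, n`, extended by zero. -/
noncomputable def truncated (B : ℕ → Ω → ℝ) (n : ℕ) (x : Ω) : ℕ → ℝ :=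
  fun j => if j ∈ Set.Icc 1 n then B j x else 0

/-- Nothing is assumed of `B` outside `1, …, n`; extension by zero makes the whole sequence
measurable. -/
lemma measurable_truncated (hB : ∀ j ∈ Set.Icc 1 n, Measurable (B j)) :
    Measurable (truncated B n) := by
  refine measurable_pi_iff.2 fun j => ?_
  unfold truncated
  split_ifs with h
  · exact hB j h
  · exact measurable_const

/-- Erasing coordinate `j` leaves a function `R` of the other service times, independent of `B j`;
Tonelli on the product law then resamples that coordinate. -/
lemma isExpSequence_map [IsProbabilityMeasure P] (hB_meas : ∀ j ∈ Set.Icc 1 n, Measurable (B j))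
    (hB_law : ∀ j ∈ Set.Icc 1 n, P.map (B j) = expMeasure μ)
    (hB_indep : iIndepFun (fun j : Set.Icc 1 n => B j) P) :
    IsExpSequence μ n (P.map (truncated B n)) := by
  intro j hj F hF
  have hT := measurable_truncated hB_meas
  have hB : ∀ p : Set.Icc 1 n, Measurable (B p) := fun p => hB_meas p p.2
  let R : Ω → ℕ → ℝ := fun x => Function.update (truncated B n x) j 0
  have hR : Measurable R := by
    refine measurable_pi_iff.2 fun p => ?_
    by_cases h : p = j
    · subst h; simp only [R, Function.update_self]; exact measurable_const
    · simp only [R, Function.update_of_ne h]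
      exact (measurable_pi_apply p).comp hT
  have hind : IndepFun (B j) R P := by
    let S : Finset (Set.Icc 1 n) := {⟨j, hj⟩}
    let T : Finset (Set.Icc 1 n) := Finset.univ.erase ⟨j, hj⟩
    have hST : Disjoint S T := by simp [S, T]
    have h := hB_indep.indepFun_finset S T hST hB
    let f : (S → ℝ) → ℝ := fun y => y ⟨⟨j, hj⟩, by simp [S]⟩
    let g : (T → ℝ) → ℕ → ℝ := fun y p =>
      if h : p ∈ Set.Icc 1 n ∧ p ≠ j then y ⟨⟨p, h.1⟩, by simp [T, h.2]⟩ else 0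
    have hf : Measurable f := measurable_pi_apply _
    have hg : Measurable g := by
      refine measurable_pi_iff.2 fun p => ?_
      simp only [g]
      split_ifs
      · exact measurable_pi_apply _
      · exact measurable_const
    have h' := h.comp hf hg
    convert! h' using 1
    ext x p
    by_cases hpj : p = j
    · subst hpj
      simp [R, g]
    · by_cases hp : p ∈ Set.Icc 1 n
      · simp only [R, g, Function.update_of_ne hpj, truncated, if_pos hp, Function.comp]
        rw [dif_pos ⟨hp, hpj⟩]
      · simp only [R, g, Function.update_of_ne hpj, truncated, if_neg hp, Function.comp]
        rw [dif_neg (fun h => hp h.1)]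
  have hBR := (indepFun_iff_map_prod_eq_prod_map_map (hB_meas j hj).aemeasurable
    hR.aemeasurable).1 hind
  rw [hB_law j hj] at hBR
  have hμp : IsProbabilityMeasure (expMeasure μ) :=
    hB_law j hj ▸ Measure.isProbabilityMeasure_map (hB_meas j hj).aemeasurable
  have hRp : IsProbabilityMeasure (P.map R) := Measure.isProbabilityMeasure_map hR.aemeasurable
  have hup : Measurable fun p : ℝ × (ℕ → ℝ) => F (Function.update p.2 j p.1) := by
    have := (hF.comp (measurable_update_pair j 0)).comp measurable_swap
    simpa [Function.comp_def] using this
  have hup' : Measurable fun b : ℕ → ℝ => ∫⁻ x, F (Function.update b j x) ∂expMeasure μ :=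
    hup.lintegral_prod_left'
  have hTR : ∀ x, truncated B n x = Function.update (R x) j (B j x) := by
    intro x
    simp only [R, Function.update_idem]
    rw [eq_comm, Function.update_eq_self_iff, truncated, if_pos hj]
  rw [lintegral_map hF hT, lintegral_map hup' hT]
  calc ∫⁻ x, F (truncated B n x) ∂P
      = ∫⁻ p, F (Function.update p.2 j p.1) ∂(P.map fun x => (B j x, R x)) := by
        rw [lintegral_map hup ((hB_meas j hj).prodMk hR)]
        simp only [← hTR]
    _ = ∫⁻ b, ∫⁻ y, F (Function.update b j y) ∂expMeasure μ ∂(P.map R) := by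
        rw [hBR, lintegral_prod_symm' _ hup]
    _ = _ := by
        rw [lintegral_map hup' hR]
        simp only [R, Function.update_idem]

/-- By memorylessness, conditioning on `u < B` replaces that service time by `u` plus a fresh
exponential; the factor `exp (-(μ * u))` cancels against the normalisation. -/
lemma lintegral_cost [IsProbabilityMeasure P] (hμ : 0 < μ) (hw : w ∈ Set.Icc (0 : ℝ) 1)
    {m i k : ℕ} (hB_meas : ∀ j ∈ Set.Icc 1 (i + m), Measurable (B j))
    (hB_law : ∀ j ∈ Set.Icc 1 (i + m), P.map (B j) = expMeasure μ)
    (hB_indep : iIndepFun (fun j : Set.Icc 1 (i + m) => B j) P)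
    (hk1 : 1 ≤ k) (hki : k ≤ i) {u : ℝ} (hu : 0 ≤ u) (π : Policy) :
    ∫⁻ x, ENNReal.ofReal (cost w (i + m) i k u π fun j => B j x)
      ∂(ProbabilityTheory.cond P {x | u < B (i + 1 - k) x}) =
    residualMean (P.map (truncated B (i + m))) (recCost w π m i k u) (i + 1 - k) u := by
  have hQ := isExpSequence_map hB_meas hB_law hB_indep
  have hT := measurable_truncated hB_meas
  set Q := P.map (truncated B (i + m)) with hQdef
  have hQp : IsProbabilityMeasure Q := Measure.isProbabilityMeasure_map hT.aemeasurable
  have hj : i + 1 - k ∈ Set.Icc 1 (i + m) := ⟨by omega, by omega⟩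
  have hs : MeasurableSet {x | u < B (i + 1 - k) x} :=
    measurableSet_lt measurable_const (hB_meas _ hj)
  have hPs : P {x | u < B (i + 1 - k) x} = expMeasure μ (Set.Ioi u) := by
    rw [← hB_law _ hj, Measure.map_apply (hB_meas _ hj) measurableSet_Ioi]
    rfl
  have hR : Measurable (recCost w π m i k u) :=
    (measurable_recCost w π m i k).comp
      (f := fun b : ℕ → ℝ => ((u, b) : ℝ × (ℕ → ℝ))) (by fun_prop)
  have hs' : MeasurableSet {b : ℕ → ℝ | u < b (i + 1 - k)} :=
    measurableSet_lt measurable_const (measurable_pi_apply _)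
  have hpos : ∀ᵐ x ∂P, ∀ j ∈ Set.Icc 1 (i + m), 0 < B j x := by
    refine ae_all_iff.2 fun j => ?_
    by_cases h : j ∈ Set.Icc 1 (i + m)
    · have := ae_pos_expMeasure μ
      rw [← hB_law j h] at this
      filter_upwards [ae_of_ae_map (hB_meas j h).aemeasurable this] with x hx _ using hx
    · exact .of_forall fun x h' => absurd h' h
  have h1 : ∫⁻ x in {x | u < B (i + 1 - k) x},
        ENNReal.ofReal (cost w (i + m) i k u π fun j => B j x) ∂P =
      ∫⁻ b in {b : ℕ → ℝ | u < b (i + 1 - k)}, recCost w π m i k u b ∂Q := by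
    rw [hQdef, setLIntegral_map hs' hR hT]
    have hpre : truncated B (i + m) ⁻¹' {b | u < b (i + 1 - k)} = {x | u < B (i + 1 - k) x} := by
      ext x
      simp only [Set.mem_preimage, Set.mem_ofPred_eq, truncated, if_pos hj]
    rw [hpre]
    refine setLIntegral_congr_fun_ae hs ?_
    filter_upwards [hpos] with x hx hxu
    rw [ofReal_cost hw hk1 hki hu ⟨fun j h => hx j ⟨by have := h.1; omega, h.2⟩, fun _ => hxu⟩]
    refine recCost_congr hki u fun j h => ?_
    rw [truncated, if_pos ⟨by have := h.1; omega, h.2⟩]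
  have h2 : ∫⁻ b in {b : ℕ → ℝ | u < b (i + 1 - k)}, recCost w π m i k u b ∂Q =
      expMeasure μ (Set.Ioi u) * residualMean Q (recCost w π m i k u) (i + 1 - k) u := by
    rw [← lintegral_indicator hs', ← residualMean_zero Q _ (i + 1 - k),
      hQ.residualMean_eq' hμ hj (hR.indicator hs'), hQ.residualMean_eq' hμ hj hR,
      ← setLIntegral_Ioi_expMeasure hμ hu
        (fun x => ∫⁻ b, recCost w π m i k u (Function.update b (i + 1 - k) x) ∂Q),
      ← lintegral_indicator measurableSet_Ioi]
    refine lintegral_congr fun x => ?_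
    by_cases hx : u < x
    · rw [Set.indicator_of_mem (Set.mem_Ioi.2 hx)]
      refine lintegral_congr fun b => ?_
      rw [zero_add, Set.indicator_of_mem (by simpa using hx)]
    · rw [Set.indicator_of_notMem (by simpa using hx), ← lintegral_zero (μ := Q)]
      refine lintegral_congr fun b => ?_
      rw [zero_add, Set.indicator_of_notMem (by simpa using hx)]
  rw [ProbabilityTheory.cond, lintegral_smul_measure, h1, h2, hPs, smul_eq_mul, ← mul_assoc,
    ENNReal.inv_mul_cancel, one_mul]
  · rw [expMeasure_Ioi hμ hu]
    simpa using Real.exp_pos _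
  · rw [expMeasure_Ioi hμ hu]
    exact ENNReal.ofReal_ne_top

lemma minCost_eq [IsProbabilityMeasure P] (hμ : 0 < μ) (hw : w ∈ Set.Icc (0 : ℝ) 1)
    {m i k : ℕ} (hB_meas : ∀ j ∈ Set.Icc 1 (i + m), Measurable (B j))
    (hB_law : ∀ j ∈ Set.Icc 1 (i + m), P.map (B j) = expMeasure μ)
    (hB_indep : iIndepFun (fun j : Set.Icc 1 (i + m) => B j) P)
    (hk1 : 1 ≤ k) (hki : k ≤ i) {u : ℝ} (hu : 0 ≤ u) :
    minCost P B w (i + m) i k u = optCost μ w m k := by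
  have hT := measurable_truncated hB_meas
  have : IsProbabilityMeasure (P.map (truncated B (i + m))) :=
    Measure.isProbabilityMeasure_map hT.aemeasurable
  rw [← (isExpSequence_map hB_meas hB_law hB_indep).iInf_residualMean hμ hw hk1 hki hu]
  exact iInf_congr fun π => lintegral_cost hμ hw hB_meas hB_law hB_indep hk1 hki hu π

/-! ### The limit of the waiting time -/

/-- Each term is a power of `t` times a decaying exponential. -/
lemma tendsto_pow_mul_poissonSum (hμ : 0 < μ) (a m : ℕ) :
    Tendsto (fun t : ℝ => t ^ a * poissonSum m (μ * t)) atTop (𝓝 0) := by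
  have h : ∀ j, Tendsto (fun t : ℝ => t ^ a * poissonTerm j (μ * t)) atTop (𝓝 0) := by
    intro j
    have h1 := ((Real.tendsto_pow_mul_exp_neg_atTop_nhds_zero (a + j)).comp
      (tendsto_id.const_mul_atTop hμ)).const_mul ((μ ^ a * (j.factorial : ℝ))⁻¹)
    rw [mul_zero] at h1
    refine h1.congr fun t => ?_
    have : μ ^ a ≠ 0 := by positivity
    simp only [Function.comp, id, poissonTerm, pow_add, mul_pow]
    field_simp
  have := tendsto_finsetSum (Finset.range m) fun j _ => h j
  simpa only [poissonSum, Finset.mul_sum, Finset.sum_const_zero] using this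

lemma tendsto_waitTerm (hμ : 0 < μ) (k : ℕ) :
    Tendsto (waitTerm μ k) atTop (𝓝 ((k : ℝ) * ((k : ℝ) - 1) / (2 * μ))) := by
  have h1 := (tendsto_pow_mul_poissonSum hμ 1 k).const_mul ((k : ℝ) - 1)
  have h2 := (tendsto_pow_mul_poissonSum hμ 2 (k - 1)).const_mul (μ / 2)
  have h3 := ((tendsto_pow_mul_poissonSum hμ 0 (k + 1)).const_sub 1).const_mul
    ((k : ℝ) * ((k : ℝ) - 1) / (2 * μ))
  have h := (h1.sub h2).add h3
  simp only [mul_zero, sub_zero, zero_add, mul_one] at h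
  refine h.congr' ?_
  filter_upwards [eventually_ge_atTop 0] with t ht
  rw [waitTerm_eq (by positivity), waitValue]
  ring

end

end Appointment

theorem theorem1 {Ω : Type*} [MeasurableSpace Ω] (P : Measure Ω) [IsProbabilityMeasure P]
    (n : ℕ) (μ w : ℝ) (hμ : 0 < μ) (hw : w ∈ Set.Icc (0 : ℝ) 1)
    (B : ℕ → Ω → ℝ) (hB_meas : ∀ j ∈ Set.Icc 1 n, Measurable (B j))
    (hB_law : ∀ j ∈ Set.Icc 1 n, P.map (B j) = expMeasure μ)
    (hB_indep : iIndepFun (fun j : Set.Icc 1 n => B j) P) :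
    -- `C_i(k, u)` is finite and does not depend on `u`; its value is `C_i(k)`
    (∀ i ∈ Set.Icc 1 n, ∀ k ∈ Set.Icc 1 i, ∀ u : ℝ, 0 ≤ u →
      Appointment.minCost P B w n i k u ≠ ⊤ ∧
      Appointment.minCost P B w n i k u = Appointment.minCost P B w n i k 0) ∧
    -- the recursion
    (∀ i ∈ Set.Ico 1 n, ∀ k ∈ Set.Icc 1 i,
      IsGLB ((fun t : ℝ => w * Appointment.idleTerm μ k t + (1 - w) * Appointment.waitTerm μ k t +
          ∑ l ∈ Finset.Icc 1 (k + 1),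
            Appointment.trans μ k l t * (Appointment.minCost P B w n (i + 1) l 0).toReal) ''
          Set.Ici (0 : ℝ))
        (Appointment.minCost P B w n i k 0).toReal) ∧
    -- the terminal condition
    (∀ k ∈ Set.Icc 1 n,
      Tendsto (Appointment.waitTerm μ k) atTop (𝓝 ((k : ℝ) * ((k : ℝ) - 1) / (2 * μ))) ∧
      (Appointment.minCost P B w n n k 0).toReal =
        (1 - w) * ((k : ℝ) * ((k : ℝ) - 1) / (2 * μ))) := by
  -- The minimal cost depends on `i` and `n` only through `n - i`, and not on `u`, so all claims
  -- about it reduce to `optCost`.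
  have key : ∀ i k u, i ≤ n → 1 ≤ k → k ≤ i → 0 ≤ u →
      Appointment.minCost P B w n i k u = Appointment.optCost μ w (n - i) k := by
    intro i k u hi hk1 hki hu
    obtain ⟨m, rfl⟩ := Nat.exists_eq_add_of_le hi
    rw [Appointment.minCost_eq hμ hw hB_meas hB_law hB_indep hk1 hki hu, Nat.add_sub_cancel_left]
  refine ⟨fun i hi k hk u hu => ?_, fun i hi k hk => ?_, fun k hk => ⟨?_, ?_⟩⟩
  · rw [key i k u hi.2 hk.1 hk.2 hu, key i k 0 hi.2 hk.1 hk.2 le_rfl]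
    exact ⟨Appointment.optCost_ne_top hμ hw _ _, rfl⟩
  · have hi1 := hi.1
    have hi2 := hi.2
    have hk2 := hk.2
    have h := Appointment.isGLB_optCost hμ hw (n - (i + 1)) k
    rw [show n - (i + 1) + 1 = n - i by omega] at h
    rw [key i k 0 (by omega) hk.1 hk.2 le_rfl]
    convert! h using 1
    refine Set.image_congr fun t ht => ?_
    rw [← Appointment.stepValue_eq (mul_nonneg hμ.le ht)]
    congr 1
    refine Finset.sum_congr rfl fun l hl => ?_
    rw [Finset.mem_Icc] at hl
    rw [key (i + 1) l 0 (by omega) hl.1 (by omega) le_rfl]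
  · exact Appointment.tendsto_waitTerm hμ k
  · have hk1 : (1 : ℝ) ≤ k := by exact_mod_cast hk.1
    rw [key n k 0 le_rfl hk.1 hk.2 le_rfl, Nat.sub_self, Appointment.optCost,
      ENNReal.toReal_ofReal]
    exact mul_nonneg (sub_nonneg.2 hw.2)
      (div_nonneg (mul_nonneg (by linarith) (by linarith)) (by linarith))
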